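/- Let $k$ be a field and let $\Lambda$ be a finite dimensional $k$-algebra of finite global dimension. Let $\operatorname{mod}\Lambda$ be the category of finitely generated left $\Lambda$-modules and let $$\mathcal U=\mathcal U(\Lambda)=\operatorname{add}\{A[i]\mid A\in\operatorname{mod}\Lambda,\ i\in\mathbb Z\}\subset D^b(\operatorname{mod}\Lambda)$$ be its Yoneda category, i.e. the full subcategory of the bounded derived category whose objects are the direct summands of finite direct sums of shifts of $\Lambda$-modules. Then $\mathcal U$ is a $1$-Gorenstein dualizing $k$-variety. Here, for a $k$-linear category $\mathcal C$, a $\mathcal C$-module is a contravariant $k$-linear functor from $\mathcal C$ to $k$-vector spaces, and $\operatorname{mod}\mathcal C$ (resp. $\operatorname{mod}\mathcal C^{\mathrm{op}}$) is the category of finitely presented $\mathcal C$-modules (resp. $\mathcal C^{\mathrm{op}}$-modules), that is, of cokernels of morphisms $\mathcal C(-,B)\to\mathcal C(-,A)$ (resp. $\mathcal C(B,-)\to\mathcal C(A,-)$). The category $\mathcal C$ is a dualizing $k$-variety if all its $\operatorname{Hom}$-spaces are finite dimensional over $k$ and the functors $D=\operatorname{Hom}_k(-,k)$ between $\mathcal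 C$-modules and $\mathcal C^{\mathrm{op}}$-modules restrict to a duality $\operatorname{mod}\mathcal C\leftrightarrow\operatorname{mod}\mathcal C^{\mathrm{op}}$. It is $d$-Gorenstein if it is coherent, i.e. it has weak kernels and weak cokernels (so that $\operatorname{mod}\mathcal C$ and $\operatorname{mod}\mathcal C^{\mathrm{op}}$ are abelian), and, for every object $X$ of $\mathcal C$, the module $\mathcal C(-,X)$ has injective dimension at most $d$ in $\operatorname{mod}\mathcal C$ and the module $\mathcal C(X,-)$ has injective dimension at most $d$ in $\operatorname{mod}\mathcal C^{\mathrm{op}}$. -/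

import Mathlib

open CategoryTheory CategoryTheory.Limits Opposite

universe w u v₁

noncomputable section

/-! ## Modules over a `k`-linear category

For a `k`-linear category `C`, a `C`-module is a contravariant `k`-linear functor from `C` to
`k`-modules (this is the same thing as an additive functor to abelian groups: the action of `k` is
recovered from the action of the scalar endomorphisms), and a `Cᵒᵖ`-module is a covariant one.
Finitely presented functors are cokernels of maps between representable functors, so that they are
automatically `k`-linear; this is why the linearity does not appear in the definitions below. -/

namespace LinearCat

variable (k : Type u) [Field k] (C : Type v₁) [Category.{max u w} C] [Preadditive C] [Linear k C]

/-- A functor `F : Cᵒᵖ ⥤ ModuleCat k` is a finitely presented `C`-module if there is an exact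
sequence `C(-,B) ⟶ C(-,A) ⟶ F ⟶ 0` with `A B : C`. -/
def fpRight : ObjectProperty (Cᵒᵖ ⥤ ModuleCat.{max u w} k) := fun F =>
  ∃ (B A : C) (f : (linearYoneda k C).obj B ⟶ (linearYoneda k C).obj A)
    (p : (linearYoneda k C).obj A ⟶ F) (zero : f ≫ p = 0),
    (ShortComplex.mk f p zero).Exact ∧ Epi p

/-- A functor `G : C ⥤ ModuleCat k` is a finitely presented `Cᵒᵖ`-module if there is an exact
sequence `C(B,-) ⟶ C(A,-) ⟶ G ⟶ 0` with `A B : C`. -/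
def fpLeft : ObjectProperty (C ⥤ ModuleCat.{max u w} k) := fun G =>
  ∃ (B A : C) (f : (linearCoyoneda k C).obj (op B) ⟶ (linearCoyoneda k C).obj (op A))
    (p : (linearCoyoneda k C).obj (op A) ⟶ G) (zero : f ≫ p = 0),
    (ShortComplex.mk f p zero).Exact ∧ Epi p

/-- The category `mod C` of finitely presented `C`-modules. -/
abbrev ModRight := (fpRight.{w} k C).FullSubcategory

/-- The category `mod Cᵒᵖ` of finitely presented `Cᵒᵖ`-modules. -/
abbrev ModLeft := (fpLeft.{w} k C).FullSubcategory

lemma fpRight_representable (X : C) : fpRight.{w} k C ((linearYoneda k C).obj X) :=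
  ⟨X, X, 0, 𝟙 _, by simp, (ShortComplex.exact_iff_mono _ rfl).2 (by dsimp; infer_instance),
    inferInstance⟩

lemma fpLeft_representable (X : C) : fpLeft.{w} k C ((linearCoyoneda k C).obj (op X)) :=
  ⟨X, X, 0, 𝟙 _, by simp, (ShortComplex.exact_iff_mono _ rfl).2 (by dsimp; infer_instance),
    inferInstance⟩

/-- The representable module `C(-,X)` as an object of `mod C`. -/
def reprRight (X : C) : ModRight.{w} k C := ⟨_, fpRight_representable.{w} k C X⟩

/-- The representable module `C(X,-)` as an object of `mod Cᵒᵖ`. -/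
def reprLeft (X : C) : ModLeft.{w} k C := ⟨_, fpLeft_representable.{w} k C X⟩

/-- `M ↦ Hom_k(M, k)` as a contravariant endofunctor of the category of `k`-modules. -/
def dualModule : (ModuleCat.{max u w} k)ᵒᵖ ⥤ ModuleCat.{max u w} k where
  obj M := ModuleCat.of k (Module.Dual k M.unop)
  map f := ModuleCat.ofHom f.unop.hom.dualMap

/-- The duality `D = Hom_k(-,k)` from `C`-modules to `Cᵒᵖ`-modules: `(D F)(X) = Hom_k(F X, k)`. -/
def dualRight : (Cᵒᵖ ⥤ ModuleCat.{max u w} k)ᵒᵖ ⥤ (C ⥤ ModuleCat.{max u w} k) where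
  obj F := F.unop.rightOp ⋙ dualModule.{w} k
  map α := Functor.whiskerRight (NatTrans.rightOp α.unop) (dualModule.{w} k)

/-- The duality `D = Hom_k(-,k)` from `Cᵒᵖ`-modules to `C`-modules: `(D G)(X) = Hom_k(G X, k)`. -/
def dualLeft : (C ⥤ ModuleCat.{max u w} k)ᵒᵖ ⥤ (Cᵒᵖ ⥤ ModuleCat.{max u w} k) where
  obj G := G.unop.op ⋙ dualModule.{w} k
  map α := Functor.whiskerRight (NatTrans.op α.unop) (dualModule.{w} k)

/-- A `k`-linear category `C` is a dualizing `k`-variety if it is `Hom`-finite and if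
`D = Hom_k(-,k)` induces a duality between `mod C` and `mod Cᵒᵖ`: both functors `D` preserve
finitely presented modules, and the induced functors `(mod C)ᵒᵖ ⥤ mod Cᵒᵖ` and
`(mod Cᵒᵖ)ᵒᵖ ⥤ mod C` are equivalences of categories. -/
structure IsDualizingVariety : Prop where
  hom_finite : ∀ X Y : C, Module.Finite k (X ⟶ Y)
  duality_right : ∃ h : ∀ F : (ModRight.{w} k C)ᵒᵖ,
      fpLeft.{w} k C (((fpRight.{w} k C).ι.op ⋙ dualRight.{w} k C).obj F),
    ((fpLeft.{w} k C).lift ((fpRight.{w} k C).ι.op ⋙ dualRight.{w} k C) h).IsEquivalence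
  duality_left : ∃ h : ∀ G : (ModLeft.{w} k C)ᵒᵖ,
      fpRight.{w} k C (((fpLeft.{w} k C).ι.op ⋙ dualLeft.{w} k C).obj G),
    ((fpRight.{w} k C).lift ((fpLeft.{w} k C).ι.op ⋙ dualLeft.{w} k C) h).IsEquivalence

/-- A preadditive category is coherent if it has weak kernels and weak cokernels (the latter are
the weak kernels in the opposite category). -/
structure IsCoherent (C : Type*) [Category* C] [Preadditive C] : Prop where
  weakKernels : HasWeakKernels C
  weakCokernels : HasWeakKernels Cᵒᵖ

/-- A coherent `k`-linear category `C` is `d`-Gorenstein if all the representable modules `C(-,X)`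
and `C(X,-)` have injective dimension at most `d` in the abelian categories `mod C` and `mod Cᵒᵖ`
respectively. (Being abelian is a property of the preadditive categories `mod C` and `mod Cᵒᵖ`,
with the pointwise addition of natural transformations; it is asserted here because the
injective dimension is formed in these abelian categories.) -/
structure IsGorenstein (d : ℕ) : Prop where
  coherent : IsCoherent C
  injectiveDimension_right : ∃ a : Abelian (ModRight.{w} k C),
    a.toPreadditive = (inferInstance : Preadditive (ModRight.{w} k C)) ∧
      ∀ X : C, HasInjectiveDimensionLE (reprRight.{w} k C X) d
  injectiveDimension_left : ∃ a : Abelian (ModLeft.{w} k C),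
    a.toPreadditive = (inferInstance : Preadditive (ModLeft.{w} k C)) ∧
      ∀ X : C, HasInjectiveDimensionLE (reprLeft.{w} k C X) d

end LinearCat

/-! ## The Yoneda category of an algebra -/

/-- A finite dimensional algebra over a field is a (left) Noetherian ring. -/
lemma isNoetherianRing_of_finiteDimensional (k : Type*) (L : Type*) [Field k] [Ring L] [Algebra k L]
    [Module.Finite k L] : IsNoetherianRing L :=
  isNoetherian_of_tower k inferInstance

section Yoneda

variable (L : Type u) [Ring L] [IsNoetherianRing L]

/-- `L` has finite global dimension: the projective dimensions of the finitely generated left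
`L`-modules are bounded. -/
def HasFiniteGlobalDimension : Prop :=
  ∃ n : ℕ, ∀ M : FGModuleCat.{u} L, HasProjectiveDimensionLE M n

variable [HasDerivedCategory.{max u w} (FGModuleCat.{u} L)]

/-- The objects of `add {A[i] | A ∈ mod L, i ∈ ℤ}` in the derived category of `mod L`: the direct
summands (retracts, which is the same in a triangulated category) of the finite direct sums of
shifts of modules. They all have bounded cohomology, so that this is also the additive closure
formed in the bounded derived category, which is the full subcategory of the derived category
on the objects with bounded cohomology. -/
def yonedaProperty : ObjectProperty (DerivedCategory.{max u w} (FGModuleCat.{u} L)) := fun X =>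
  ∃ (n : ℕ) (A : Fin n → FGModuleCat.{u} L) (i : Fin n → ℤ),
    Nonempty (Retract X
      (⨁ fun j => (shiftFunctor _ (i j)).obj ((DerivedCategory.singleFunctor _ 0).obj (A j))))

/-- The Yoneda category of `L`. -/
abbrev YonedaCategory := (yonedaProperty.{w} L).FullSubcategory

/-- The Yoneda category is contained in the bounded derived category. -/
lemma yonedaProperty_le_bounded :
    yonedaProperty.{w} L ≤ (DerivedCategory.TStructure.t (C := FGModuleCat.{u} L)).bounded := by
  rintro X ⟨n, A, i, ⟨r⟩⟩
  have hb (j : Fin n) : |i j| ≤ ∑ j, |i j| :=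
    Finset.single_le_sum (f := fun j => |i j|) (fun _ _ => abs_nonneg _) (Finset.mem_univ j)
  set N : ℤ := ∑ j, |i j|
  have key (m : ℤ) (hm : ∀ j, IsZero ((DerivedCategory.homologyFunctor (FGModuleCat.{u} L) m).obj
      ((shiftFunctor _ (i j)).obj ((DerivedCategory.singleFunctor _ 0).obj (A j))))) :
      IsZero ((DerivedCategory.homologyFunctor (FGModuleCat.{u} L) m).obj X) := by
    rw [IsZero.iff_id_eq_zero, ← CategoryTheory.Functor.map_id, ← r.retract, ← Category.id_comp r.r,
      ← biproduct.total, Preadditive.sum_comp, Preadditive.comp_sum, CategoryTheory.Functor.map_sum]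
    refine Finset.sum_eq_zero fun j _ => ?_
    simp only [CategoryTheory.Functor.map_comp, Category.assoc]
    rw [(hm j).eq_of_src ((DerivedCategory.homologyFunctor _ m).map
      (biproduct.ι (fun j => (shiftFunctor _ (i j)).obj
        ((DerivedCategory.singleFunctor _ 0).obj (A j))) j)) 0]
    simp
  refine ⟨⟨-N, (DerivedCategory.isGE_iff _ _).2 fun m hm => key m fun j => ?_⟩,
    ⟨N, (DerivedCategory.isLE_iff _ _).2 fun m hm => key m fun j => ?_⟩⟩
  · have := DerivedCategory.TStructure.t.isGE_shift
      ((DerivedCategory.singleFunctor _ 0).obj (A j)) 0 (i j) (-i j) (by lia)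
    refine DerivedCategory.isZero_of_isGE _ (-i j) m ?_
    have := hb j
    have := le_abs_self (i j)
    lia
  · have := DerivedCategory.TStructure.t.isLE_shift
      ((DerivedCategory.singleFunctor _ 0).obj (A j)) 0 (i j) (-i j) (by lia)
    refine DerivedCategory.isZero_of_isLE _ (-i j) m ?_
    have := hb j
    have := neg_le_abs (i j)
    lia

end Yoneda

end

/-! Write `U` for the Yoneda category and `T` for the derived category of `mod Λ`. Everything rests
on a good choice of weak kernels. Let `f : X ⟶ Y` be a morphism of `U` with fibre `K` in `T`, and
suppose that there is a triangle `Z ⟶ K ⟶ B` with `Z` and `B` in `U` such that `K ⟶ B` kills all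
maps from `U`. Then `g : Z ⟶ K ⟶ X` is a weak kernel of `f` in `U`. Moreover a map from `Z` that
kills every `b` with `b ≫ g = 0` factors through `g`: testing on `B⟦-1⟧ ⟶ Z` gives a factorization
through `K`, and testing on a lift of `Y⟦-1⟧ ⟶ K` gives one through `X`
(`exists_injective_weakKernel`). Weak kernels make the finitely presented functors an abelian
category with projective representables, and the factorization property says exactly that `Ext²(F,
U(-,V))` vanishes for every finitely presented `F`, whence injective dimension at most one.

The triangle comes from finite global dimension (`hasRightResolution_of_isKInjective`). Modules are
then bounded complexes of injectives in `T`, and so is the fibre `K` of a map between finite sums of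
their shifts. Take for `Z` the cycles of this complex and for `B` the quotient by them. Both have
zero differential, hence are sums of shifted modules; a map in `T` from a shifted module to `K` is a
chain map, so it lands in the cycles. Complexes of projectives and opcycles give the dual statement
for weak cokernels.

For the duality, `D` is exact, so it is enough that duals of representables are finitely presented.
On `U` the functor `D T(Λ⟦n⟧,-)` is represented by `(DΛ)⟦n⟧`, by a perfect trace pairing
(`tracePairing_single_isPerfPair`). The objects `X` for which all `D T(X⟦n⟧,-)` are finitely
presented on `U` form a thick subcategory (`fpDualCoyoneda_isTriangulated`); containing `Λ`, it
contains every module, by finite projective dimension. The other side starts from `DΛ` and uses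
injective resolutions. -/

noncomputable section

/-! ## Finitely presented objects with respect to a family of objects -/

namespace PresentedObjects

open Preadditive

variable {A : Type*} [Category* A] [Abelian A] {ι : Type*} (p : ι → A)

/-- The cokernels of the morphisms between objects of the family `p`. -/
def fp : ObjectProperty A := fun F =>
  ∃ (b a : ι) (f : p b ⟶ p a) (q : p a ⟶ F) (zero : f ≫ q = 0),
    (ShortComplex.mk f q zero).Exact ∧ Epi q

/-- The objects of the family `p` are projective with respect to the quotients of `F`. -/
def HasLifts (F : A) : Prop :=
  ∀ ⦃i : ι⦄ ⦃G : A⦄ (q : F ⟶ G) [Epi q] (φ : p i ⟶ G), ∃ ψ : p i ⟶ F, ψ ≫ q = φ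

/-- The conditions which make the cokernels of the morphisms between objects of `p` an abelian
subcategory. -/
structure IsCoherentFamily : Prop where
  hasLifts (i : ι) : HasLifts p (p i)
  biprod (i j : ι) : ∃ l, Nonempty (p i ⊞ p j ≅ p l)
  zero : ∃ i, IsZero (p i)
  weakKernel {i j : ι} (f : p i ⟶ p j) :
    ∃ (l : ι) (g : p l ⟶ p i) (zero : g ≫ f = 0), (ShortComplex.mk g f zero).Exact

variable {p}

omit [Abelian A] in
lemma HasLifts.of_epi {F G : A} (hF : HasLifts p F) (q : F ⟶ G) [Epi q] : HasLifts p G := by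
  intro i H r _ φ
  obtain ⟨ψ, hψ⟩ := hF (q ≫ r) φ
  exact ⟨ψ ≫ q, by simpa using hψ⟩

instance : (fp p).IsClosedUnderIsomorphisms where
  of_iso := by
    rintro F G e ⟨b, a, f, q, zero, h, hq⟩
    refine ⟨b, a, f, q ≫ e.hom, by simp [reassoc_of% zero], ?_, inferInstance⟩
    exact ShortComplex.exact_of_iso (S₁ := ShortComplex.mk f q zero)
      (ShortComplex.isoMk (Iso.refl _) (Iso.refl _) e (by simp) (by simp)) h

/-- Dimension shifting: a class in `Ext²(F, X)` comes from a map `φ` on the second syzygy, which is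
a quotient of `P₂`. The extension property lets `φ` extend to `P₁`, and then its class vanishes.
Only `P₁` and `P₀` need to be projective. -/
lemma hasInjectiveDimensionLE_one_of_presentations {B : Type*} [Category* B] [Abelian B] (X : B)
    (h : ∀ F : B, ∃ (P₂ P₁ P₀ : B) (g : P₂ ⟶ P₁) (f : P₁ ⟶ P₀) (q : P₀ ⟶ F) (w' : g ≫ f = 0)
      (w : f ≫ q = 0), (ShortComplex.mk g f w').Exact ∧ (ShortComplex.mk f q w).Exact ∧ Epi q ∧
      Projective P₁ ∧ Projective P₀ ∧ ∀ z : P₂ ⟶ X,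
        (∀ ⦃K : B⦄ (b : K ⟶ P₂), b ≫ g = 0 → b ≫ z = 0) → ∃ y : P₁ ⟶ X, g ≫ y = z) :
    HasInjectiveDimensionLE X 1 := by
  let := HasExt.standard B
  have : EnoughProjectives B := ⟨fun F => by
    obtain ⟨_, _, P₀, _, _, q, _, _, _, _, _, _, _, _⟩ := h F
    exact ⟨⟨P₀, q⟩⟩⟩
  refine hasInjectiveDimensionLT_of_enoughProjectives X 2 fun F => ⟨fun a b => ?_⟩
  suffices ∀ e : Abelian.Ext F X 2, e = 0 by rw [this a, this b]
  intro e
  obtain ⟨P₂, P₁, P₀, g, f, q, w', w, hgf, hfq, _, _, _, hz⟩ := h F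
  have h₁ : (ShortComplex.mk (kernel.ι q) q (kernel.condition q)).ShortExact :=
    { exact := ShortComplex.exact_kernel q }
  let f' : P₁ ⟶ kernel q := kernel.lift q f w
  have hf' : f' ≫ kernel.ι q = f := kernel.lift_ι _ _ _
  have : Epi f' := hfq.epi_kernelLift
  have h₂ : (ShortComplex.mk (kernel.ι f') f' (kernel.condition f')).ShortExact :=
    { exact := ShortComplex.exact_kernel f' }
  obtain ⟨e₁, rfl⟩ := Abelian.Ext.contravariant_sequence_exact₃ h₁ X e
    (Abelian.Ext.eq_zero_of_projective _) (show 1 + 1 = 2 from rfl)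
  obtain ⟨e₀, rfl⟩ := Abelian.Ext.contravariant_sequence_exact₃ h₂ X e₁
    (Abelian.Ext.eq_zero_of_projective _) (show 1 + 0 = 1 from rfl)
  obtain ⟨φ, rfl⟩ := Abelian.Ext.homEquiv₀.symm.surjective e₀
  let r : P₂ ⟶ kernel f' := kernel.lift f' g (by
    rw [← cancel_mono (kernel.ι q), Category.assoc, hf', w', zero_comp])
  have hr : r ≫ kernel.ι f' = g := kernel.lift_ι _ _ _
  have : Epi r := by
    rw [epi_iff_surjective_up_to_refinements]
    intro K y
    obtain ⟨K', π, _, x, hx⟩ := hgf.exact_up_to_refinements (y ≫ kernel.ι f') (by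
      change (y ≫ kernel.ι f') ≫ f = 0
      conv_lhs => rw [← hf', Category.assoc, kernel.condition_assoc, zero_comp, comp_zero])
    dsimp at x hx
    exact ⟨K', π, inferInstance, x, by
      rw [← cancel_mono (kernel.ι f'), Category.assoc, Category.assoc, hr, hx]⟩
  -- Since `P₂` covers the second syzygy and the latter embeds in `P₁`, whatever `g` kills is
  -- already killed by `r`, hence by `r ≫ φ`.
  obtain ⟨y, hy⟩ := hz (r ≫ φ) fun K b hb => by
    have : b ≫ r = 0 := by rw [← cancel_mono (kernel.ι f'), Category.assoc, hr, hb, zero_comp]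
    rw [reassoc_of% this, zero_comp]
  have hφ : φ = kernel.ι f' ≫ y := by rw [← cancel_epi r, ← hy, ← hr, Category.assoc]
  have : h₂.extClass.comp (Abelian.Ext.homEquiv₀.symm φ) rfl = 0 := by
    rw [Abelian.Ext.homEquiv₀_symm_apply, hφ, ← Abelian.Ext.mk₀_comp_mk₀,
      h₂.extClass_comp_assoc]
  rw [this, Abelian.Ext.comp_zero]

namespace IsCoherentFamily

variable (hp : IsCoherentFamily p)
include hp

/-- The ambient category will be that of all functors, linear or not, where representables are
projective only relative to linear functors. `HasLifts` records this relative projectivity and is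
inherited by quotients. -/
lemma hasLifts_of_fp {F : A} (hF : fp p F) : HasLifts p F := by
  obtain ⟨b, a, f, q, zero, h, hq⟩ := hF
  exact (hp.hasLifts a).of_epi q

/-- Over a coherent family, the kernel of a morphism to a finitely presented object is finitely
generated. -/
lemma exists_exact {F : A} (hF : fp p F) {a : ι} (φ : p a ⟶ F) :
    ∃ (l : ι) (g : p l ⟶ p a) (zero : g ≫ φ = 0), (ShortComplex.mk g φ zero).Exact := by
  obtain ⟨b', a', f, q, zero, h, hq⟩ := hF
  obtain ⟨ψ, hψ⟩ := hp.hasLifts a' q φ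
  -- An element of `p a` dies in `F` exactly when its image under `ψ` lies in the image of `f`. So
  -- the kernel is the projection to `p a` of the kernel of `(ψ, f)` on `p a ⊞ p b'`.
  obtain ⟨l₀, ⟨e⟩⟩ := hp.biprod a b'
  obtain ⟨l, g, hg, hex⟩ := hp.weakKernel (e.inv ≫ biprod.desc ψ f)
  have hfst : g ≫ e.inv ≫ biprod.fst ≫ ψ = - (g ≫ e.inv ≫ biprod.snd ≫ f) := by
    rw [eq_neg_iff_add_eq_zero, ← hg]
    simp [biprod.desc_eq]
  refine ⟨l, g ≫ e.inv ≫ biprod.fst, ?_, ?_⟩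
  · rw [← hψ]
    simp only [Category.assoc]
    simp only [← Category.assoc] at hfst ⊢
    rw [hfst]
    simp [zero]
  · rw [ShortComplex.exact_iff_exact_up_to_refinements]
    intro X x hx
    dsimp at x hx
    obtain ⟨X', π, _, y, hy⟩ := h.exact_up_to_refinements (x ≫ ψ) (by simp [hψ, hx])
    dsimp at y hy
    obtain ⟨X'', π', _, z, hz⟩ := hex.exact_up_to_refinements (biprod.lift (π ≫ x) (-y) ≫ e.hom)
      (by simp [biprod.lift_desc, hy])
    dsimp at z hz
    refine ⟨X'', π' ≫ π, inferInstance, z, ?_⟩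
    dsimp
    have := hz =≫ (e.inv ≫ biprod.fst)
    simpa using this

/-- A finitely generated subobject of a finitely presented object is finitely presented. -/
lemma fp_of_mono {N F : A} (hF : fp p F) (i : N ⟶ F) [Mono i] {a : ι} (r : p a ⟶ N) [Epi r] :
    fp p N := by
  obtain ⟨l, g, zero, h⟩ := hp.exists_exact hF (r ≫ i)
  have zero' : g ≫ r = 0 := by simpa [← cancel_mono i] using zero
  refine ⟨l, a, g, r, zero', ?_, inferInstance⟩
  rw [ShortComplex.exact_iff_exact_up_to_refinements]
  intro X x hx
  exact h.exact_up_to_refinements x (by dsimp at hx ⊢; rw [reassoc_of% hx, zero_comp])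

/-- Keep the generators of `G`; to its relations add lifts of the images of the generators of `F`.
-/
lemma fp_of_cokernel {F G H : A} (hF : fp p F) (hG : fp p G) (φ : F ⟶ G) (c : G ⟶ H)
    (w : φ ≫ c = 0) (hex : (ShortComplex.mk φ c w).Exact) [Epi c] : fp p H := by
  obtain ⟨_, d, _, s, _, _, _⟩ := hF
  obtain ⟨b, a, f, q, zero, h, hq⟩ := hG
  obtain ⟨t, ht⟩ := hp.hasLifts a q (s ≫ φ)
  obtain ⟨l, ⟨e⟩⟩ := hp.biprod b d
  refine ⟨l, a, e.inv ≫ biprod.desc f t, q ≫ c, ?_, ?_, inferInstance⟩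
  · rw [Category.assoc, Preadditive.IsIso.comp_left_eq_zero]
    ext
    · simp [reassoc_of% zero]
    · simp [reassoc_of% ht, w]
  · rw [ShortComplex.exact_iff_exact_up_to_refinements]
    intro X x hx
    dsimp at x hx
    obtain ⟨X₁, π₁, _, y, hy⟩ := hex.exact_up_to_refinements (x ≫ q) (by simpa using hx)
    dsimp at y hy
    obtain ⟨X₂, π₂, _, z, hz⟩ := surjective_up_to_refinements_of_epi s y
    obtain ⟨X₃, π₃, _, v, hv⟩ := h.exact_up_to_refinements (π₂ ≫ π₁ ≫ x - z ≫ t) (by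
      dsimp
      rw [sub_comp, Category.assoc, Category.assoc, Category.assoc, ht, hy, reassoc_of% hz,
        sub_self])
    dsimp at v hv
    refine ⟨X₃, π₃ ≫ π₂ ≫ π₁, inferInstance, biprod.lift v (π₃ ≫ z) ≫ e.hom, ?_⟩
    simp only [comp_sub, sub_eq_iff_eq_add] at hv
    simp [biprod.lift_desc, hv]

/-- The kernel of `p c ⟶ F ⟶ G` is finitely generated and surjects onto `K`, which is a subobject of
the finitely presented `F`. -/
lemma fp_of_kernel {K F G : A} (hF : fp p F) (hG : fp p G) (k : K ⟶ F) (φ : F ⟶ G)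
    (w : k ≫ φ = 0) (hex : (ShortComplex.mk k φ w).Exact) [Mono k] : fp p K := by
  obtain ⟨_, c, _, s, _, _, _⟩ := id hF
  obtain ⟨d, g, hg, h⟩ := hp.exists_exact hG (s ≫ φ)
  let r : p d ⟶ K := hex.lift (g ≫ s) (by simpa using hg)
  have hr : r ≫ k = g ≫ s := hex.lift_f _ _
  have : Epi r := by
    rw [epi_iff_surjective_up_to_refinements]
    intro X x
    obtain ⟨X₁, π₁, _, y, hy⟩ := surjective_up_to_refinements_of_epi s (x ≫ k)
    obtain ⟨X₂, π₂, _, z, hz⟩ := h.exact_up_to_refinements y (by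
      dsimp
      rw [← Category.assoc, ← hy]
      simp [w])
    dsimp at z hz
    refine ⟨X₂, π₂ ≫ π₁, inferInstance, z, ?_⟩
    rw [← cancel_mono k]
    simp only [Category.assoc, hr, hy, reassoc_of% hz]
  exact hp.fp_of_mono hF k r

/-- Horseshoe construction. The hypothesis `hM` supplies the lift of the generators of `G` to `M`;
it is not automatic, because an extension of linear functors in the ambient category need not be
linear. -/
lemma fp_of_extension {F M G : A} (hF : fp p F) (hG : fp p G) (hM : HasLifts p M) (i : F ⟶ M)
    (c : M ⟶ G) (w : i ≫ c = 0) (hex : (ShortComplex.mk i c w).ShortExact) : fp p M := by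
  have := hex.mono_f
  have := hex.epi_g
  dsimp at *
  have hFl := hp.hasLifts_of_fp hF
  obtain ⟨b, a, f, q, zero, h, hq⟩ := hF
  obtain ⟨b', a', f', q', zero', h', hq'⟩ := hG
  obtain ⟨t, ht⟩ := hM c q'
  let s : p b' ⟶ F := hex.exact.lift (f' ≫ t) (by simp [ht, zero'])
  have hs : s ≫ i = f' ≫ t := hex.exact.lift_f _ _
  obtain ⟨v, hv⟩ := hp.hasLifts a q s
  obtain ⟨l, ⟨e⟩⟩ := hp.biprod a a'
  obtain ⟨l', ⟨e'⟩⟩ := hp.biprod b b'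
  have hepi : Epi (biprod.desc (q ≫ i) t) := by
    rw [epi_iff_surjective_up_to_refinements]
    intro X x
    obtain ⟨X₁, π₁, _, y, hy⟩ := surjective_up_to_refinements_of_epi q' (x ≫ c)
    obtain ⟨X₂, π₂, _, z, hz⟩ := hex.exact.exact_up_to_refinements (π₁ ≫ x - y ≫ t)
      (by dsimp; simp [ht, hy])
    dsimp at z hz
    obtain ⟨X₃, π₃, _, m, hm⟩ := surjective_up_to_refinements_of_epi q z
    refine ⟨X₃, π₃ ≫ π₂ ≫ π₁, inferInstance, biprod.lift m (π₃ ≫ π₂ ≫ y), ?_⟩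
    simp only [comp_sub, sub_eq_iff_eq_add] at hz
    simp [biprod.lift_desc, hz, reassoc_of% hm]
  -- A relation `f'` of `G` lifts to `M` only up to an element of `F`, the image of `v`; this is the
  -- off-diagonal entry `-v`.
  refine ⟨l', l, e'.inv ≫ biprod.desc (biprod.lift f 0) (biprod.lift (-v) f') ≫ e.hom,
    e.inv ≫ biprod.desc (q ≫ i) t, ?_, ?_, inferInstance⟩
  · simp only [Category.assoc, Iso.hom_inv_id_assoc]
    rw [Preadditive.IsIso.comp_left_eq_zero]
    ext
    · simp [biprod.lift_desc, reassoc_of% zero]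
    · simp [biprod.lift_desc, reassoc_of% hv, hs]
  · rw [ShortComplex.exact_iff_exact_up_to_refinements]
    intro X x hx
    dsimp at x hx
    obtain ⟨x, rfl⟩ : ∃ y, x = y ≫ e.hom := ⟨x ≫ e.inv, by simp⟩
    simp only [Category.assoc, Iso.hom_inv_id_assoc, biprod.desc_eq, comp_add] at hx
    have hx' := hx =≫ c
    simp only [add_comp, Category.assoc, w, comp_zero, zero_add, ht, zero_comp] at hx'
    obtain ⟨X₁, π₁, _, y, hy⟩ := h'.exact_up_to_refinements (x ≫ biprod.snd) (by simpa using hx')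
    dsimp at y hy
    obtain ⟨X₂, π₂, _, z, hz⟩ := h.exact_up_to_refinements (π₁ ≫ x ≫ biprod.fst + y ≫ v) (by
      dsimp
      rw [← cancel_mono i]
      have := π₁ ≫= hx
      simp only [comp_add, comp_zero] at this
      simp only [add_comp, Category.assoc, hv, hs, zero_comp]
      rw [← this]
      congr 1
      simpa using (hy =≫ t).symm)
    dsimp at z hz
    refine ⟨X₂, π₂ ≫ π₁, inferInstance, biprod.lift z (π₂ ≫ y) ≫ e'.hom, ?_⟩
    simp only [comp_add] at hz
    dsimp
    simp only [Category.assoc, Iso.hom_inv_id_assoc, ← cancel_mono e.inv, Iso.hom_inv_id,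
      Category.comp_id, biprod.lift_desc]
    ext
    · simp [← hz]
    · simp [hy]

/-- The middle term is an extension of `ker f₄` by `coker f₁`. This is the form in which long exact
sequences are used. -/
lemma fp_of_exact₅ {F₁ F₂ M F₄ F₅ : A} (h₁ : fp p F₁) (h₂ : fp p F₂) (h₄ : fp p F₄)
    (h₅ : fp p F₅) (hM : HasLifts p M) (f₁ : F₁ ⟶ F₂) (f₂ : F₂ ⟶ M) (f₃ : M ⟶ F₄) (f₄ : F₄ ⟶ F₅)
    (w₁ : f₁ ≫ f₂ = 0) (w₂ : f₂ ≫ f₃ = 0) (w₃ : f₃ ≫ f₄ = 0)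
    (e₁ : (ShortComplex.mk f₁ f₂ w₁).Exact) (e₂ : (ShortComplex.mk f₂ f₃ w₂).Exact)
    (e₃ : (ShortComplex.mk f₃ f₄ w₃).Exact) : fp p M := by
  have hc : fp p (cokernel f₁) := hp.fp_of_cokernel h₁ h₂ f₁ (cokernel.π f₁) (by simp)
    (ShortComplex.exact_cokernel f₁)
  have hk : fp p (kernel f₄) := hp.fp_of_kernel h₄ h₅ (kernel.ι f₄) f₄ (by simp)
    (ShortComplex.exact_kernel f₄)
  have h₁' : cokernel.desc f₁ f₂ w₁ ≫ kernel.lift f₄ f₃ w₃ = 0 := by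
    ext
    simp [w₂]
  refine hp.fp_of_extension hc hk hM (cokernel.desc f₁ f₂ w₁) (kernel.lift f₄ f₃ w₃) h₁'
    { exact := ?_, mono_f := ?_, epi_g := ?_ }
  · rw [ShortComplex.exact_iff_exact_up_to_refinements] at e₂ ⊢
    intro X x hx
    obtain ⟨X', π, _, y, hy⟩ := e₂ x (by simpa using hx =≫ kernel.ι f₄)
    exact ⟨X', π, inferInstance, y ≫ cokernel.π f₁, by simpa using hy⟩
  · exact e₁.mono_cokernelDesc
  · exact e₃.epi_kernelLift

lemma fp_family (i : ι) : fp p (p i) := by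
  obtain ⟨j, hj⟩ := hp.zero
  refine ⟨j, i, 0, 𝟙 _, by simp, ?_, inferInstance⟩
  exact (ShortComplex.exact_iff_mono _ rfl).2 (by dsimp; infer_instance)

lemma fp_biprod {F G : A} (hF : fp p F) (hG : fp p G) : fp p (F ⊞ G) := by
  refine hp.fp_of_extension hF hG ?_ biprod.inl biprod.snd (by simp)
    (ShortComplex.Splitting.ofHasBinaryBiproduct F G).shortExact
  obtain ⟨_, a, _, q, _, _, _⟩ := hF
  obtain ⟨_, a', _, q', _, _, _⟩ := hG
  obtain ⟨l, ⟨e⟩⟩ := hp.biprod a a'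
  exact (hp.hasLifts l).of_epi (e.inv ≫ biprod.map q q')

lemma containsZero : (fp p).ContainsZero where
  exists_zero := by
    obtain ⟨i, hi⟩ := hp.zero
    exact ⟨p i, hi, hp.fp_family i⟩

lemma fp_of_retract {F G : A} (r : Retract F G) (hG : fp p G) : fp p F := by
  refine hp.fp_of_cokernel hG hG (𝟙 G - r.r ≫ r.i) r.r (by simp) ?_
  rw [ShortComplex.exact_iff_exact_up_to_refinements]
  intro X x hx
  dsimp at x hx
  exact ⟨X, 𝟙 X, inferInstance, x, by simp [reassoc_of% hx]⟩

lemma isClosedUnderFiniteProducts : (fp p).IsClosedUnderFiniteProducts := by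
  have := hp.containsZero
  have : (fp p).IsClosedUnderBinaryProducts := by
    refine .mk ?_
    rintro X ⟨h⟩
    let e : X ≅ h.diag.obj ⟨.left⟩ ⊞ h.diag.obj ⟨.right⟩ :=
      IsLimit.conePointsIsoOfNatIso h.isLimit (BinaryBiproduct.isLimit _ _) (diagramIsoPair h.diag)
    exact (fp p).prop_of_iso e.symm (hp.fp_biprod (h.prop_diag_obj _) (h.prop_diag_obj _))
  exact .mk'

lemma isClosedUnderKernels : (fp p).IsClosedUnderKernels where
  kernels_le := by
    rintro _ ⟨f, k, hk, hf⟩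
    have := mono_of_isLimit_fork hk
    exact hp.fp_of_kernel hf.1 hf.2 k.ι f k.condition (ShortComplex.exact_of_f_is_kernel _
      (IsLimit.ofIsoLimit hk (Fork.ext (Iso.refl _) (by simp))))

lemma isClosedUnderCokernels : (fp p).IsClosedUnderCokernels where
  cokernels_le := by
    rintro _ ⟨f, k, hk, hf⟩
    have := epi_of_isColimit_cofork hk
    exact hp.fp_of_cokernel hf.1 hf.2 f k.π k.condition (ShortComplex.exact_of_g_is_cokernel _
      (IsColimit.ofIsoColimit hk (Cofork.ext (Iso.refl _) (by simp))))

/-- The finitely presented objects form an abelian category. -/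
abbrev abelian : Abelian (fp p).FullSubcategory :=
  haveI := hp.containsZero
  haveI := hp.isClosedUnderKernels
  haveI := hp.isClosedUnderCokernels
  haveI := hp.isClosedUnderFiniteProducts
  inferInstance

/-- The inclusion of the finitely presented objects preserves homology. -/
lemma preservesHomology_ι :
    letI := hp.abelian
    (fp p).ι.PreservesHomology :=
  haveI := hp.isClosedUnderKernels
  haveI := hp.isClosedUnderCokernels
  { preservesKernels := (fp p).preservesKernels_ι
    preservesCokernels := (fp p).preservesCokernels_ι }

/-- The objects of the family `p` as finitely presented objects. -/
abbrev toFp (i : ι) : (fp p).FullSubcategory := ⟨p i, hp.fp_family i⟩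

lemma exact_of_exact_ι {F G H : (fp p).FullSubcategory} (f : F ⟶ G) (g : G ⟶ H)
    (w : f.hom ≫ g.hom = 0) (h : (ShortComplex.mk f.hom g.hom w).Exact) :
    letI := hp.abelian
    ∃ w' : f ≫ g = 0, (ShortComplex.mk f g w').Exact := by
  let := hp.abelian
  have := hp.preservesHomology_ι
  refine ⟨by ext; exact w, ?_⟩
  rw [← ShortComplex.exact_map_iff_of_faithful _ (fp p).ι]
  exact h

lemma projective_toFp (i : ι) : Projective (hp.toFp i) where
  factors {F G} φ q _ := by
    let := hp.abelian
    have := hp.preservesHomology_ι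
    have : Epi ((fp p).ι.map q) := inferInstance
    obtain ⟨ψ, hψ⟩ := hp.hasLifts_of_fp F.property ((fp p).ι.map q) φ.hom
    exact ⟨(fp p).homMk ψ, by ext; exact hψ⟩

/-- If weak kernels in the family `p` can be chosen so that a morphism `z` to `p x` from a weak
kernel `g` of a morphism factors through `g` as soon as `b ≫ g = 0` implies `b ≫ z = 0`, then
`p x` has injective dimension at most one. -/
lemma hasInjectiveDimensionLE_one (x : ι)
    (hx : ∀ ⦃i j : ι⦄ (f : p i ⟶ p j), ∃ (l : ι) (g : p l ⟶ p i) (zero : g ≫ f = 0),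
      (ShortComplex.mk g f zero).Exact ∧ ∀ z : p l ⟶ p x,
        (∀ (m : ι) (b : p m ⟶ p l), b ≫ g = 0 → b ≫ z = 0) → ∃ y : p i ⟶ p x, g ≫ y = z) :
    letI := hp.abelian
    HasInjectiveDimensionLE (hp.toFp x) 1 := by
  let := hp.abelian
  refine hasInjectiveDimensionLE_one_of_presentations _ fun F => ?_
  obtain ⟨i, j, f, q, zero, hex, hq⟩ := F.property
  obtain ⟨l, g, hg, hex', h⟩ := hx f
  obtain ⟨w, hw⟩ := hp.exact_of_exact_ι (F := hp.toFp i) (G := hp.toFp j) (H := F)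
    ((fp p).homMk f) ((fp p).homMk q) zero hex
  obtain ⟨w', hw'⟩ := hp.exact_of_exact_ι (F := hp.toFp l) (G := hp.toFp i) (H := hp.toFp j)
    ((fp p).homMk g) ((fp p).homMk f) hg hex'
  refine ⟨_, _, _, _, _, _, w', w, hw', hw, ?_, hp.projective_toFp _, hp.projective_toFp _, ?_⟩
  · exact ((fp p).ι.epi_of_epi_map (by exact hq))
  · intro z hz
    obtain ⟨y, hy⟩ := h z.hom fun m b hb => by
      have : (fp p).homMk (X := hp.toFp m) (Y := hp.toFp l) b ≫ z = 0 :=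
        hz _ (by ext; exact hb)
      exact congr_arg (·.hom) this
    exact ⟨(fp p).homMk y, by ext; exact hy⟩

end IsCoherentFamily

end PresentedObjects

/-! ## Exactness in categories of functors to modules -/

section FunctorExactness

variable {k : Type*} [Field k] {J : Type*} [Category* J]

lemma functor_exact_iff_evaluation {A : Type*} [Category* A] [Abelian A]
    (S : ShortComplex (J ⥤ A)) :
    S.Exact ↔ ∀ X, (S.map ((evaluation J A).obj X)).Exact := by
  rw [S.exact_iff_isZero_homology, Functor.isZero_iff]
  refine forall_congr' fun X => ?_
  rw [ShortComplex.exact_iff_isZero_homology]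
  exact (S.mapHomologyIso ((evaluation J A).obj X)).isZero_iff.symm

lemma functor_exact_iff {S : ShortComplex (J ⥤ ModuleCat k)} :
    S.Exact ↔ ∀ X, Function.Exact (S.f.app X) (S.g.app X) := by
  rw [functor_exact_iff_evaluation]
  exact forall_congr' fun X => ShortComplex.ShortExact.moduleCat_exact_iff_function_exact _

lemma functor_epi_iff {F G : J ⥤ ModuleCat k} (q : F ⟶ G) :
    Epi q ↔ ∀ X, Function.Surjective (q.app X) := by
  rw [NatTrans.epi_iff_epi_app]
  exact forall_congr' fun X => ModuleCat.epi_iff_surjective _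

lemma functor_mono_iff {F G : J ⥤ ModuleCat k} (q : F ⟶ G) :
    Mono q ↔ ∀ X, Function.Injective (q.app X) := by
  rw [NatTrans.mono_iff_mono_app]
  exact forall_congr' fun X => ModuleCat.mono_iff_injective _

lemma exact_dualMap {V₁ V₂ V₃ : Type*} [AddCommGroup V₁] [AddCommGroup V₂] [AddCommGroup V₃]
    [Module k V₁] [Module k V₂] [Module k V₃] {f : V₁ →ₗ[k] V₂} {g : V₂ →ₗ[k] V₃}
    (h : Function.Exact f g) : Function.Exact g.dualMap f.dualMap := by
  rw [LinearMap.exact_iff] at h ⊢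
  rw [LinearMap.ker_dualMap_eq_dualAnnihilator_range,
    LinearMap.range_dualMap_eq_dualAnnihilator_ker, h]

lemma dualMap_left_injective {V₁ V₂ : Type*} [AddCommGroup V₁] [AddCommGroup V₂]
    [Module k V₁] [Module k V₂] {f g : V₁ →ₗ[k] V₂} (h : f.dualMap = g.dualMap) : f = g := by
  ext x
  refine (Module.forall_dual_apply_eq_zero_iff k (f x - g x)).1 (fun φ => ?_) |> sub_eq_zero.1
  have := congr($h φ x)
  simp only [LinearMap.dualMap_apply] at this
  rw [map_sub, this, sub_self]

end FunctorExactness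

/-! ### Representable functors, weak kernels and the Gorenstein condition -/

namespace LinearCat

open PresentedObjects ZeroObject

/-- Every morphism `f` has a weak kernel `g` such that the morphisms from the source of `g`
which annihilate all the `b` with `b ≫ g = 0` factor through `g`. -/
def HasInjectiveWeakKernels (C : Type*) [Category* C] [Preadditive C] : Prop :=
  ∀ ⦃X Y : C⦄ (f : X ⟶ Y), ∃ (Z : C) (g : Z ⟶ X), g ≫ f = 0 ∧
    (∀ ⦃W : C⦄ (h : W ⟶ X), h ≫ f = 0 → ∃ l : W ⟶ Z, l ≫ g = h) ∧
    ∀ ⦃V : C⦄ (z : Z ⟶ V), (∀ ⦃W : C⦄ (b : W ⟶ Z), b ≫ g = 0 → b ≫ z = 0) →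
      ∃ x : X ⟶ V, g ≫ x = z

lemma HasInjectiveWeakKernels.hasWeakKernels {C : Type*} [Category* C] [Preadditive C]
    (h : HasInjectiveWeakKernels C) : HasWeakKernels C where
  hasWeakLimit f := by
    obtain ⟨Z, g, hg, hl, -⟩ := h f
    choose l hl using hl
    exact HasWeakLimit.mk ⟨KernelFork.ofι g hg, Fork.IsWeakLimit.mk' _ fun s =>
      ⟨l s.ι (KernelFork.condition s), hl _ _⟩⟩

variable (k : Type u) [Field k] (C : Type v₁) [Category.{max u w} C] [Preadditive C] [Linear k C]

instance : (linearYoneda k C).Additive where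
  map_add {X Y} f g := by
    ext W (h : W.unop ⟶ X)
    exact Preadditive.comp_add _ _ _ h f g

instance : (linearCoyoneda k C).Additive where
  map_add {X Y} f g := by
    ext W (h : X.unop ⟶ W)
    exact Preadditive.add_comp _ _ _ f.unop g.unop h

variable {k C}

lemma exists_eq_linearYoneda_map {X Y : C}
    (f : (linearYoneda k C).obj X ⟶ (linearYoneda k C).obj Y) :
    ∃ f' : X ⟶ Y, f = (linearYoneda k C).map f' :=
  ⟨_, ((linearYoneda k C).map_preimage f).symm⟩

lemma exists_eq_linearCoyoneda_map {X Y : C}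
    (f : (linearCoyoneda k C).obj (op X) ⟶ (linearCoyoneda k C).obj (op Y)) :
    ∃ f' : Y ⟶ X, f = (linearCoyoneda k C).map f'.op :=
  ⟨((linearCoyoneda k C).preimage f).unop, ((linearCoyoneda k C).map_preimage f).symm⟩

/-- A linear functor has the lifting property with respect to representable functors. -/
lemma hasLifts_right (F : Cᵒᵖ ⥤ ModuleCat.{max u w} k)
    (hadd : ∀ ⦃X Y : C⦄ (f g : X ⟶ Y), F.map (f + g).op = F.map f.op + F.map g.op)
    (hsmul : ∀ ⦃X Y : C⦄ (c : k) (f : X ⟶ Y), F.map (c • f).op = c • F.map f.op) :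
    HasLifts (linearYoneda k C).obj F := by
  intro i G q hq φ
  obtain ⟨x, hx⟩ := (functor_epi_iff q).1 hq (op i) (φ.app (op i) (𝟙 i))
  refine ⟨{
    app := fun X => ModuleCat.ofHom
      { toFun := fun (f : X.unop ⟶ i) => F.map f.op x
        map_add' := fun f g => by rw [hadd]; rfl
        map_smul' := fun c f => by rw [hsmul]; rfl }
    naturality := fun X Y g => ?_ }, ?_⟩
  · ext (f : X.unop ⟶ i)
    change F.map (g.unop ≫ f).op x = F.map g (F.map f.op x)
    simp
  · ext X (f : X.unop ⟶ i)
    change q.app X (F.map f.op x) = φ.app X f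
    have h₁ := congr($(q.naturality f.op) x)
    have h₂ := congr($(φ.naturality f.op) (𝟙 i))
    exact h₁.trans ((congr_arg (G.map f.op) hx).trans (h₂.symm.trans
      (congr_arg (φ.app X) (Category.comp_id f))))

lemma hasLifts_left (F : C ⥤ ModuleCat.{max u w} k)
    (hadd : ∀ ⦃X Y : C⦄ (f g : X ⟶ Y), F.map (f + g) = F.map f + F.map g)
    (hsmul : ∀ ⦃X Y : C⦄ (c : k) (f : X ⟶ Y), F.map (c • f) = c • F.map f) :
    HasLifts (fun A : C => (linearCoyoneda k C).obj (op A)) F := by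
  intro i G q hq φ
  obtain ⟨x, hx⟩ := (functor_epi_iff q).1 hq i (φ.app i (𝟙 i))
  refine ⟨{
    app := fun X => ModuleCat.ofHom
      { toFun := fun (f : i ⟶ X) => F.map f x
        map_add' := fun f g => by rw [hadd]; rfl
        map_smul' := fun c f => by rw [hsmul]; rfl }
    naturality := fun X Y g => ?_ }, ?_⟩
  · ext (f : i ⟶ X)
    change F.map (f ≫ g) x = F.map g (F.map f x)
    simp
  · ext X (f : i ⟶ X)
    change q.app X (F.map f x) = φ.app X f
    have h₁ := congr($(q.naturality f) x)
    have h₂ := congr($(φ.naturality f) (𝟙 i))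
    exact h₁.trans ((congr_arg (G.map f) hx).trans (h₂.symm.trans
      (congr_arg (φ.app X) (Category.id_comp f))))

lemma linearYoneda_exact {X Y Z : C} (g : Z ⟶ X) (f : X ⟶ Y) (hg : g ≫ f = 0)
    (hl : ∀ ⦃W : C⦄ (h : W ⟶ X), h ≫ f = 0 → ∃ l : W ⟶ Z, l ≫ g = h) :
    ∃ w : (linearYoneda k C).map g ≫ (linearYoneda k C).map f = 0,
      (ShortComplex.mk _ _ w).Exact := by
  have w : (linearYoneda k C).map g ≫ (linearYoneda k C).map f = 0 := by
    rw [← Functor.map_comp, hg, Functor.map_zero]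
  refine ⟨w, functor_exact_iff.2 fun W h => ⟨fun hh => hl h hh, ?_⟩⟩
  rintro ⟨l, rfl⟩
  exact congr(($w).app W l)

lemma linearCoyoneda_exact {X Y Z : C} (g : X ⟶ Z) (f : Y ⟶ X) (hg : f ≫ g = 0)
    (hl : ∀ ⦃W : C⦄ (h : X ⟶ W), f ≫ h = 0 → ∃ l : Z ⟶ W, g ≫ l = h) :
    ∃ w : (linearCoyoneda k C).map g.op ≫ (linearCoyoneda k C).map f.op = 0,
      (ShortComplex.mk _ _ w).Exact := by
  have w : (linearCoyoneda k C).map g.op ≫ (linearCoyoneda k C).map f.op = 0 := by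
    rw [← Functor.map_comp, ← op_comp, hg, op_zero, Functor.map_zero]
  refine ⟨w, functor_exact_iff.2 fun W h => ⟨fun hh => hl h hh, ?_⟩⟩
  rintro ⟨l, rfl⟩
  exact congr(($w).app W l)

section Gorenstein

variable [HasZeroObject C] [HasBinaryBiproducts C]

variable (k) in
lemma isCoherentFamily_right (hC : HasInjectiveWeakKernels C) :
    IsCoherentFamily (linearYoneda k C).obj where
  hasLifts i := hasLifts_right.{w} _
    (fun X Y f g => by ext h; exact Preadditive.add_comp _ _ _ f g h)
    (fun X Y c f => by ext h; exact Linear.smul_comp _ _ _ c f h)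
  biprod i j :=
    haveI := preservesBinaryBiproducts_of_preservesBiproducts (linearYoneda k C)
    ⟨i ⊞ j, ⟨((linearYoneda k C).mapBiprod i j).symm⟩⟩
  zero := ⟨0, (linearYoneda k C).map_isZero (isZero_zero C)⟩
  weakKernel {i j} f := by
    obtain ⟨f, rfl⟩ := exists_eq_linearYoneda_map.{w} f
    obtain ⟨Z, g, hg, hl, -⟩ := hC f
    obtain ⟨w, hw⟩ := linearYoneda_exact.{w} (k := k) g f hg hl
    exact ⟨Z, _, w, hw⟩

variable (k) in
lemma isCoherentFamily_left (hC : HasInjectiveWeakKernels Cᵒᵖ) :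
    IsCoherentFamily (fun A : C => (linearCoyoneda k C).obj (op A)) where
  hasLifts i := hasLifts_left.{w} _
    (fun X Y f g => by ext h; exact Preadditive.comp_add _ _ _ h f g)
    (fun X Y c f => by ext h; exact Linear.comp_smul _ _ _ h c f)
  biprod i j :=
    haveI := preservesBinaryBiproducts_of_preservesBiproducts (linearCoyoneda k C)
    ⟨(op i ⊞ op j).unop, ⟨((linearCoyoneda k C).mapBiprod (op i) (op j)).symm⟩⟩
  zero := ⟨0, (linearCoyoneda k C).map_isZero (isZero_zero C).op⟩
  weakKernel {i j} f := by
    obtain ⟨f, rfl⟩ := exists_eq_linearCoyoneda_map.{w} f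
    obtain ⟨Z, g, hg, hl, -⟩ := hC f.op
    obtain ⟨w, hw⟩ := linearCoyoneda_exact.{w} (k := k) g.unop f (Quiver.Hom.op_inj hg)
      fun W h hh => by
        obtain ⟨l, hl⟩ := hl h.op (Quiver.Hom.unop_inj hh)
        exact ⟨l.unop, Quiver.Hom.op_inj hl⟩
    exact ⟨Z.unop, _, w, hw⟩

lemma isGorenstein_one (hC : HasInjectiveWeakKernels C) (hC' : HasInjectiveWeakKernels Cᵒᵖ) :
    IsGorenstein.{w} k C 1 where
  coherent := ⟨hC.hasWeakKernels, hC'.hasWeakKernels⟩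
  injectiveDimension_right := by
    refine ⟨(isCoherentFamily_right.{w} k hC).abelian, rfl, fun X => ?_⟩
    refine (isCoherentFamily_right.{w} k hC).hasInjectiveDimensionLE_one X fun i j f => ?_
    obtain ⟨f, rfl⟩ := exists_eq_linearYoneda_map.{w} f
    obtain ⟨Z, g, hg, hl, hz⟩ := hC f
    obtain ⟨w, hw⟩ := linearYoneda_exact.{w} (k := k) g f hg hl
    refine ⟨Z, _, w, hw, fun z hz' => ?_⟩
    obtain ⟨z, rfl⟩ := exists_eq_linearYoneda_map.{w} z
    obtain ⟨x, rfl⟩ := hz z fun W b hb => (linearYoneda k C).map_injective (by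
      rw [Functor.map_comp, Functor.map_zero]
      exact hz' W _ (by rw [← Functor.map_comp, hb, Functor.map_zero]))
    exact ⟨(linearYoneda k C).map x, ((linearYoneda k C).map_comp _ _).symm⟩
  injectiveDimension_left := by
    refine ⟨(isCoherentFamily_left.{w} k hC').abelian, rfl, fun X => ?_⟩
    refine (isCoherentFamily_left.{w} k hC').hasInjectiveDimensionLE_one X fun i j f => ?_
    obtain ⟨f, rfl⟩ := exists_eq_linearCoyoneda_map.{w} f
    obtain ⟨Z, g, hg, hl, hz⟩ := hC' f.op
    obtain ⟨w, hw⟩ := linearCoyoneda_exact.{w} (k := k) g.unop f (Quiver.Hom.op_inj hg)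
      fun W h hh => by
        obtain ⟨l, hl⟩ := hl h.op (Quiver.Hom.unop_inj hh)
        exact ⟨l.unop, Quiver.Hom.op_inj hl⟩
    refine ⟨Z.unop, _, w, hw, fun z hz' => ?_⟩
    obtain ⟨z, rfl⟩ := exists_eq_linearCoyoneda_map.{w} z
    obtain ⟨x, hx⟩ := hz z.op fun W b hb => (linearCoyoneda k C).map_injective (by
      rw [Functor.map_comp, Functor.map_zero]
      exact hz' W.unop _ (by
        rw [← Functor.map_comp]
        exact (congr_arg _ hb).trans (Functor.map_zero _ _ _)))
    refine ⟨(linearCoyoneda k C).map x, ?_⟩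
    rw [← Functor.map_comp, ← hx]
    rfl

end Gorenstein

/-! ### The duality `D` on finitely presented functors -/

section Duality

set_option linter.unusedSectionVars false

lemma dualLeft_exact {F G H : C ⥤ ModuleCat.{max u w} k} (f : F ⟶ G) (g : G ⟶ H) (w' : f ≫ g = 0)
    (h : (ShortComplex.mk f g w').Exact) :
    ∃ z : (dualLeft.{w} k C).map g.op ≫ (dualLeft.{w} k C).map f.op = 0,
      (ShortComplex.mk _ _ z).Exact := by
  rw [functor_exact_iff] at h
  have h' (X : Cᵒᵖ) := exact_dualMap (h X.unop)
  exact ⟨by ext X x; exact (h' X).apply_apply_eq_zero x, functor_exact_iff.2 h'⟩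

lemma dualRight_exact {F G H : Cᵒᵖ ⥤ ModuleCat.{max u w} k} (f : F ⟶ G) (g : G ⟶ H)
    (w' : f ≫ g = 0) (h : (ShortComplex.mk f g w').Exact) :
    ∃ z : (dualRight.{w} k C).map g.op ≫ (dualRight.{w} k C).map f.op = 0,
      (ShortComplex.mk _ _ z).Exact := by
  rw [functor_exact_iff] at h
  have h' (X : C) := exact_dualMap (h (op X))
  exact ⟨by ext X x; exact (h' X).apply_apply_eq_zero x, functor_exact_iff.2 h'⟩

lemma dualLeft_mono {F G : C ⥤ ModuleCat.{max u w} k} (q : F ⟶ G) [hq : Epi q] :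
    Mono ((dualLeft.{w} k C).map q.op) :=
  (functor_mono_iff _).2 fun X =>
    LinearMap.dualMap_injective_of_surjective ((functor_epi_iff q).1 hq X.unop)

lemma dualRight_mono {F G : Cᵒᵖ ⥤ ModuleCat.{max u w} k} (q : F ⟶ G) [hq : Epi q] :
    Mono ((dualRight.{w} k C).map q.op) :=
  (functor_mono_iff _).2 fun X =>
    LinearMap.dualMap_injective_of_surjective ((functor_epi_iff q).1 hq (op X))

section

variable [HasZeroObject C] [HasBinaryBiproducts C]

/-- Exactness of `D` turns a presentation of `G` into a description of `D G` as the kernel of a map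
between duals of representables. -/
lemma fpRight_dualLeft (hC : HasInjectiveWeakKernels C)
    (hD : ∀ A : C, fpRight.{w} k C ((dualLeft.{w} k C).obj (op ((linearCoyoneda k C).obj (op A)))))
    {G : C ⥤ ModuleCat.{max u w} k} (hG : fpLeft.{w} k C G) :
    fpRight.{w} k C ((dualLeft.{w} k C).obj (op G)) := by
  obtain ⟨B, A, f, q, zero, h, hq⟩ := hG
  obtain ⟨z, hz⟩ := dualLeft_exact f q zero h
  have := dualLeft_mono q
  exact (isCoherentFamily_right.{w} k hC).fp_of_kernel (hD A) (hD B) _ _ z hz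

lemma fpLeft_dualRight (hC : HasInjectiveWeakKernels Cᵒᵖ)
    (hD : ∀ A : C, fpLeft.{w} k C ((dualRight.{w} k C).obj (op ((linearYoneda k C).obj A))))
    {G : Cᵒᵖ ⥤ ModuleCat.{max u w} k} (hG : fpRight.{w} k C G) :
    fpLeft.{w} k C ((dualRight.{w} k C).obj (op G)) := by
  obtain ⟨B, A, f, q, zero, h, hq⟩ := hG
  obtain ⟨z, hz⟩ := dualRight_exact f q zero h
  have := dualRight_mono q
  exact (isCoherentFamily_left.{w} k hC).fp_of_kernel (hD A) (hD B) _ _ z hz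

end

lemma finite_of_fpRight (hC : ∀ X Y : C, Module.Finite k (X ⟶ Y))
    {F : Cᵒᵖ ⥤ ModuleCat.{max u w} k} (hF : fpRight.{w} k C F) (X : Cᵒᵖ) :
    Module.Finite k (F.obj X) := by
  obtain ⟨B, A, f, q, zero, h, hq⟩ := hF
  have : Module.Finite k (((linearYoneda k C).obj A).obj X) := hC X.unop A
  exact Module.Finite.of_surjective (q.app X).hom ((functor_epi_iff q).1 hq X)

lemma finite_of_fpLeft (hC : ∀ X Y : C, Module.Finite k (X ⟶ Y))
    {F : C ⥤ ModuleCat.{max u w} k} (hF : fpLeft.{w} k C F) (X : C) :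
    Module.Finite k (F.obj X) := by
  obtain ⟨B, A, f, q, zero, h, hq⟩ := hF
  have : Module.Finite k (((linearCoyoneda k C).obj (op A)).obj X) := hC A X
  exact Module.Finite.of_surjective (q.app X).hom ((functor_epi_iff q).1 hq X)

/-- The inverse of the transposition for maps between finite dimensional vector spaces. -/
def predual {V W : Type*} [AddCommGroup V] [AddCommGroup W] [Module k V] [Module k W]
    [Module.Finite k W] (φ : Module.Dual k W →ₗ[k] Module.Dual k V) : V →ₗ[k] W :=
  (Module.evalEquiv k W).symm.toLinearMap ∘ₗ φ.dualMap ∘ₗ Module.Dual.eval k V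

lemma dualMap_predual {V W : Type*} [AddCommGroup V] [AddCommGroup W] [Module k V] [Module k W]
    [Module.Finite k W] (φ : Module.Dual k W →ₗ[k] Module.Dual k V) :
    (predual φ).dualMap = φ := by
  ext ψ x
  simp [predual, LinearMap.dualMap_apply, Module.apply_evalEquiv_symm_apply]

/-- The evaluation `G ⟶ D D G` is an isomorphism for a pointwise finite dimensional functor. -/
def dualRightDualLeftIso (G : C ⥤ ModuleCat.{max u w} k) [∀ X, Module.Finite k (G.obj X)] :
    G ≅ (dualRight.{w} k C).obj (op ((dualLeft.{w} k C).obj (op G))) :=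
  NatIso.ofComponents (fun X => (Module.evalEquiv k (G.obj X)).toModuleIso) (by
    intros
    rfl)

/-- The evaluation `G ⟶ D D G` is an isomorphism for a pointwise finite dimensional functor. -/
def dualLeftDualRightIso (G : Cᵒᵖ ⥤ ModuleCat.{max u w} k) [∀ X, Module.Finite k (G.obj X)] :
    G ≅ (dualLeft.{w} k C).obj (op ((dualRight.{w} k C).obj (op G))) :=
  NatIso.ofComponents (fun X => (Module.evalEquiv k (G.obj X)).toModuleIso) (by
    intros
    rfl)

lemma dualRight_map_injective {F G : Cᵒᵖ ⥤ ModuleCat.{max u w} k} {f g : F ⟶ G}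
    (h : (dualRight.{w} k C).map f.op = (dualRight.{w} k C).map g.op) : f = g := by
  ext X : 3
  exact dualMap_left_injective congr((($h).app X.unop).hom)

lemma dualLeft_map_injective {F G : C ⥤ ModuleCat.{max u w} k} {f g : F ⟶ G}
    (h : (dualLeft.{w} k C).map f.op = (dualLeft.{w} k C).map g.op) : f = g := by
  ext X : 3
  exact dualMap_left_injective congr((($h).app (op X)).hom)

lemma dualRight_map_surjective {F G : Cᵒᵖ ⥤ ModuleCat.{max u w} k}
    [∀ X, Module.Finite k (G.obj X)]
    (β : (dualRight.{w} k C).obj (op G) ⟶ (dualRight.{w} k C).obj (op F)) :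
    ∃ f : F ⟶ G, (dualRight.{w} k C).map f.op = β := by
  refine ⟨{
    app := fun X => ModuleCat.ofHom (predual (β.app X.unop).hom)
    naturality := fun X Y f => ?_ }, ?_⟩
  · ext1
    -- Transposition is faithful, so naturality may be checked after dualizing, where it is the
    -- naturality of `β`.
    apply dualMap_left_injective
    have := congr(($(β.naturality f.unop)).hom)
    have h₁ := dualMap_predual (V := F.obj X) (W := G.obj X) (β.app X.unop).hom
    have h₂ := dualMap_predual (V := F.obj Y) (W := G.obj Y) (β.app Y.unop).hom
    ext φ x
    have h₃ : (_ : Module.Dual k (F.obj X)) x = (_ : Module.Dual k (F.obj X)) x :=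
      congr((show Module.Dual k (F.obj X) from $this φ) x)
    exact (LinearMap.congr_fun (LinearMap.congr_fun h₂ φ) (F.map f x)).trans (h₃.symm.trans
      (LinearMap.congr_fun (LinearMap.congr_fun h₁ (φ ∘ₗ (G.map f).hom)) x).symm)
  · ext X : 3
    exact dualMap_predual (V := F.obj (op X)) (W := G.obj (op X)) (β.app X).hom

lemma dualLeft_map_surjective {F G : C ⥤ ModuleCat.{max u w} k}
    [∀ X, Module.Finite k (G.obj X)]
    (β : (dualLeft.{w} k C).obj (op G) ⟶ (dualLeft.{w} k C).obj (op F)) :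
    ∃ f : F ⟶ G, (dualLeft.{w} k C).map f.op = β := by
  refine ⟨{
    app := fun X => ModuleCat.ofHom (predual (β.app (op X)).hom)
    naturality := fun X Y f => ?_ }, ?_⟩
  · ext1
    apply dualMap_left_injective
    have := congr(($(β.naturality f.op)).hom)
    have h₁ := dualMap_predual (V := F.obj X) (W := G.obj X) (β.app (op X)).hom
    have h₂ := dualMap_predual (V := F.obj Y) (W := G.obj Y) (β.app (op Y)).hom
    ext φ x
    have h₃ : (_ : Module.Dual k (F.obj X)) x = (_ : Module.Dual k (F.obj X)) x :=
      congr((show Module.Dual k (F.obj X) from $this φ) x)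
    exact (LinearMap.congr_fun (LinearMap.congr_fun h₂ φ) (F.map f x)).trans (h₃.symm.trans
      (LinearMap.congr_fun (LinearMap.congr_fun h₁ (φ ∘ₗ (G.map f).hom)) x).symm)
  · ext X : 3
    exact dualMap_predual (V := F.obj X.unop) (W := G.obj X.unop) (β.app X).hom

lemma isDualizingVariety [HasZeroObject C] [HasBinaryBiproducts C]
    (hfin : ∀ X Y : C, Module.Finite k (X ⟶ Y))
    (hC : HasInjectiveWeakKernels C) (hC' : HasInjectiveWeakKernels Cᵒᵖ)
    (hD : ∀ A : C, fpRight.{w} k C ((dualLeft.{w} k C).obj (op ((linearCoyoneda k C).obj (op A)))))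
    (hD' : ∀ A : C, fpLeft.{w} k C ((dualRight.{w} k C).obj (op ((linearYoneda k C).obj A)))) :
    IsDualizingVariety.{w} k C where
  hom_finite := hfin
  duality_right := by
    refine ⟨fun F => fpLeft_dualRight hC' hD' F.unop.property, ?_⟩
    refine
      { faithful := ⟨fun {F G f g} h => ?_⟩
        full := ⟨fun {F G} β => ?_⟩
        essSurj := ⟨fun G => ?_⟩ }
    · exact Quiver.Hom.unop_inj (ObjectProperty.hom_ext _
        (dualRight_map_injective congr(($h).hom)))
    · have := finite_of_fpRight hfin F.unop.property
      obtain ⟨f, hf⟩ := dualRight_map_surjective (F := G.unop.obj) (G := F.unop.obj) β.hom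
      exact ⟨(ObjectProperty.homMk f).op, ObjectProperty.hom_ext _ hf⟩
    · have := finite_of_fpLeft hfin G.property
      exact ⟨op ⟨_, fpRight_dualLeft hC hD G.property⟩,
        ⟨(fpLeft k C).isoMk (dualRightDualLeftIso G.obj).symm⟩⟩
  duality_left := by
    refine ⟨fun F => fpRight_dualLeft hC hD F.unop.property, ?_⟩
    refine
      { faithful := ⟨fun {F G f g} h => ?_⟩
        full := ⟨fun {F G} β => ?_⟩
        essSurj := ⟨fun G => ?_⟩ }
    · exact Quiver.Hom.unop_inj (ObjectProperty.hom_ext _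
        (dualLeft_map_injective congr(($h).hom)))
    · have := finite_of_fpLeft hfin F.unop.property
      obtain ⟨f, hf⟩ := dualLeft_map_surjective (F := G.unop.obj) (G := F.unop.obj) β.hom
      exact ⟨(ObjectProperty.homMk f).op, ObjectProperty.hom_ext _ hf⟩
    · have := finite_of_fpRight hfin G.property
      exact ⟨op ⟨_, fpLeft_dualRight hC' hD' G.property⟩,
        ⟨(fpRight k C).isoMk (dualLeftDualRightIso G.obj).symm⟩⟩

end Duality

end LinearCat

/-! ## Resolutions by a shift-stable subcategory of a triangulated category -/

namespace TriangulatedResolution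

open Pretriangulated

variable {T : Type*} [Category* T] [Preadditive T] [HasZeroObject T] [HasShift T ℤ]
  [∀ n : ℤ, (shiftFunctor T n).Additive] [Pretriangulated T] (P : ObjectProperty T)

/-- There is a distinguished triangle `Z ⟶ K ⟶ B ⟶ Z⟦1⟧` with `Z` and `B` in `P` such that
`K ⟶ B` annihilates the morphisms from objects of `P`. -/
def HasRightResolution (K : T) : Prop :=
  ∃ (Z B : T) (a : Z ⟶ K) (b : K ⟶ B) (c : B ⟶ Z⟦(1 : ℤ)⟧), Triangle.mk a b c ∈ distTriang T ∧
    P Z ∧ P B ∧ ∀ ⦃U : T⦄, P U → ∀ u : U ⟶ K, u ≫ b = 0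

/-- There is a distinguished triangle `B ⟶ K ⟶ Z ⟶ B⟦1⟧` with `Z` and `B` in `P` such that
`B ⟶ K` is annihilated by the morphisms to objects of `P`. -/
def HasLeftResolution (K : T) : Prop :=
  ∃ (B Z : T) (b : B ⟶ K) (a : K ⟶ Z) (c : Z ⟶ B⟦(1 : ℤ)⟧), Triangle.mk b a c ∈ distTriang T ∧
    P Z ∧ P B ∧ ∀ ⦃U : T⦄, P U → ∀ u : K ⟶ U, b ≫ u = 0

variable {P}

lemma HasRightResolution.of_iso {K K' : T} (e : K ≅ K') (h : HasRightResolution P K) :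
    HasRightResolution P K' := by
  obtain ⟨Z, B, a, b, c, hT, hZ, hB, h⟩ := h
  have h₁ : (a ≫ e.hom) ≫ e.inv = 𝟙 Z ≫ a := by simp
  have h₂ : (e.inv ≫ b) ≫ 𝟙 B = e.inv ≫ b := by simp
  have h₃ : c ≫ (𝟙 Z)⟦(1 : ℤ)⟧' = 𝟙 B ≫ c := by simp
  refine ⟨Z, B, a ≫ e.hom, e.inv ≫ b, c, isomorphic_distinguished _ hT _
    (Triangle.isoMk _ _ (Iso.refl _) e.symm (Iso.refl _) h₁ h₂ h₃), hZ, hB, fun U hU u => ?_⟩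
  rw [← Category.assoc]
  exact h hU _

lemma HasLeftResolution.of_iso {K K' : T} (e : K ≅ K') (h : HasLeftResolution P K) :
    HasLeftResolution P K' := by
  obtain ⟨B, Z, b, a, c, hT, hZ, hB, h⟩ := h
  have h₁ : (b ≫ e.hom) ≫ e.inv = 𝟙 B ≫ b := by simp
  have h₂ : (e.inv ≫ a) ≫ 𝟙 Z = e.inv ≫ a := by simp
  have h₃ : c ≫ (𝟙 B)⟦(1 : ℤ)⟧' = 𝟙 Z ≫ c := by simp
  refine ⟨B, Z, b ≫ e.hom, e.inv ≫ a, c, isomorphic_distinguished _ hT _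
    (Triangle.isoMk _ _ (Iso.refl _) e.symm (Iso.refl _) h₁ h₂ h₃), hZ, hB, fun U hU u => ?_⟩
  rw [Category.assoc]
  exact h hU _

variable [P.IsStableUnderShift ℤ]

/-- Maps from `P` to `K` lift along `a`, so `a ≫ κ` is a weak kernel. For the extension property,
`z` has to vanish on the two obstructions to factoring through `X`: one from the triangle of `K`,
one from the triangle of `f`. -/
lemma exists_injective_weakKernel {X Y K : T} (hY : P Y) {κ : K ⟶ X} {f : X ⟶ Y}
    {δ : Y ⟶ K⟦(1 : ℤ)⟧} (hT : Triangle.mk κ f δ ∈ distTriang T) (hK : HasRightResolution P K) :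
    ∃ (Z : T) (_ : P Z) (g : Z ⟶ X), g ≫ f = 0 ∧
      (∀ ⦃W : T⦄, P W → ∀ h : W ⟶ X, h ≫ f = 0 → ∃ l : W ⟶ Z, l ≫ g = h) ∧
      ∀ ⦃V : T⦄ (z : Z ⟶ V),
        (∀ ⦃W : T⦄, P W → ∀ b : W ⟶ Z, b ≫ g = 0 → b ≫ z = 0) → ∃ x : X ⟶ V, g ≫ x = z := by
  obtain ⟨Z, B, a, b, c, hT', hZ, hB, hb⟩ := hK
  have h₀ : κ ≫ f = 0 := comp_distTriang_mor_zero₁₂ _ hT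
  have ha : ∀ ⦃W : T⦄, P W → ∀ u : W ⟶ K, ∃ m : W ⟶ Z, u = m ≫ a := fun W hW u =>
    Triangle.coyoneda_exact₂ _ hT' u (hb hW u)
  refine ⟨Z, hZ, a ≫ κ, by simp [h₀], fun W hW h hh => ?_, fun V z hz => ?_⟩
  · obtain ⟨l, hl⟩ : ∃ l : W ⟶ K, h = l ≫ κ := Triangle.coyoneda_exact₂ _ hT h hh
    obtain ⟨m, rfl⟩ := ha hW l
    exact ⟨m, by simp [hl]⟩
  · have hinv := inv_rot_of_distTriang _ hT'
    have hinv' := inv_rot_of_distTriang _ hT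
    obtain ⟨y, hy⟩ : ∃ y : K ⟶ V, z = a ≫ y := Triangle.yoneda_exact₂ _ hinv z
      -- First test object: `B⟦-1⟧ ⟶ Z`, which `a` kills and whose vanishing on `z` gives the
      -- factorization through `K`.
      (hz (P.le_shift (-1 : ℤ) _ hB) _ (by
        have : (Triangle.mk a b c).invRotate.mor₁ ≫ a = 0 := comp_distTriang_mor_zero₁₂ _ hinv
        exact (Category.assoc _ _ _).symm.trans ((this =≫ κ).trans zero_comp)))
    -- Second test object: `Y⟦-1⟧ ⟶ K` lifts to `m : Y⟦-1⟧ ⟶ Z` because `Y⟦-1⟧` is in `P`. As `m ≫ a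
    -- ≫ κ = 0`, also `m ≫ z = 0`, so `y` factors through `κ`.
    obtain ⟨m, hm⟩ := ha (P.le_shift (-1 : ℤ) _ hY) (Triangle.mk κ f δ).invRotate.mor₁
    have hd : (Triangle.mk κ f δ).invRotate.mor₁ ≫ κ = 0 := comp_distTriang_mor_zero₁₂ _ hinv'
    obtain ⟨x, hx⟩ : ∃ x : X ⟶ V, y = κ ≫ x := Triangle.yoneda_exact₂ _ hinv' y (by
      have := hz (P.le_shift (-1 : ℤ) _ hY) m (by
        rw [← Category.assoc, ← hm]
        exact hd)
      refine (hm =≫ y).trans ((Category.assoc _ _ _).trans ?_)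
      exact (congr_arg (fun t => m ≫ t) hy).symm.trans this)
    exact ⟨x, by rw [hy, hx, Category.assoc]⟩

lemma exists_injective_weakCokernel {X Y K : T} (hX : P X) {f : X ⟶ Y} {κ : Y ⟶ K}
    {δ : K ⟶ X⟦(1 : ℤ)⟧} (hT : Triangle.mk f κ δ ∈ distTriang T) (hK : HasLeftResolution P K) :
    ∃ (Z : T) (_ : P Z) (g : Y ⟶ Z), f ≫ g = 0 ∧
      (∀ ⦃W : T⦄, P W → ∀ h : Y ⟶ W, f ≫ h = 0 → ∃ l : Z ⟶ W, g ≫ l = h) ∧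
      ∀ ⦃V : T⦄ (z : V ⟶ Z),
        (∀ ⦃W : T⦄, P W → ∀ b : Z ⟶ W, g ≫ b = 0 → z ≫ b = 0) → ∃ x : V ⟶ Y, x ≫ g = z := by
  obtain ⟨B, Z, b, a, c, hT', hZ, hB, hb⟩ := hK
  have h₀ : f ≫ κ = 0 := comp_distTriang_mor_zero₁₂ _ hT
  have ha : ∀ ⦃W : T⦄, P W → ∀ u : K ⟶ W, ∃ m : Z ⟶ W, u = a ≫ m := fun W hW u =>
    Triangle.yoneda_exact₂ _ hT' u (hb hW u)
  refine ⟨Z, hZ, κ ≫ a, by rw [reassoc_of% h₀, zero_comp], fun W hW h hh => ?_, fun V z hz => ?_⟩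
  · obtain ⟨l, hl⟩ : ∃ l : K ⟶ W, h = κ ≫ l := Triangle.yoneda_exact₂ _ hT h hh
    obtain ⟨m, rfl⟩ := ha hW l
    exact ⟨m, by simp [hl]⟩
  · obtain ⟨y, hy⟩ : ∃ y : V ⟶ K, z = y ≫ a := Triangle.coyoneda_exact₃ _ hT' z
      (hz (P.le_shift (1 : ℤ) _ hB) c (by
        have : a ≫ c = 0 := comp_distTriang_mor_zero₂₃ _ hT'
        rw [Category.assoc, this, comp_zero]))
    obtain ⟨m, hm⟩ := ha (P.le_shift (1 : ℤ) _ hX) δ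
    have hd : κ ≫ δ = 0 := comp_distTriang_mor_zero₂₃ _ hT
    obtain ⟨x, hx⟩ : ∃ x : V ⟶ Y, y = x ≫ κ := Triangle.coyoneda_exact₃ _ hT y (by
      have := hz (P.le_shift (1 : ℤ) _ hX) m (by rw [Category.assoc, ← hm, hd])
      change y ≫ δ = 0
      rw [hm]
      simpa [hy] using this)
    exact ⟨x, by rw [hy, hx, Category.assoc]⟩

variable {G : ObjectProperty T}

/-- If every object of `P` is a retract of an object of `G` and the fibers of the morphisms
between objects of `G` have right resolutions, then `P` has injective weak kernels. -/
lemma hasInjectiveWeakKernels (hGP : G ≤ P)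
    (hPG : ∀ X, P X → ∃ (X' : T) (_ : G X'), Nonempty (Retract X X'))
    (hR : ∀ Tr ∈ distTriang T, G Tr.obj₂ → G Tr.obj₃ → HasRightResolution P Tr.obj₁) :
    LinearCat.HasInjectiveWeakKernels P.FullSubcategory := by
  intro X Y f
  obtain ⟨X', hX', ⟨rX⟩⟩ := hPG _ X.property
  obtain ⟨Y', hY', ⟨rY⟩⟩ := hPG _ Y.property
  -- Resolutions are available for maps between objects of `G` only, so `f` is replaced by `X' ⟶ X ⟶
  -- Y ⟶ Y'`; its weak kernel, followed by the retraction to `X`, serves for `f`.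
  obtain ⟨K, κ, δ, hT⟩ := distinguished_cocone_triangle₁ (rX.r ≫ f.hom ≫ rY.i)
  obtain ⟨Z, hZ, g, hg, hl, hz⟩ := exists_injective_weakKernel (hGP _ hY') hT (hR _ hT hX' hY')
  have hf : rX.i ≫ rX.r ≫ f.hom ≫ rY.i = f.hom ≫ rY.i := by simp
  have hgf : g ≫ rX.r ≫ f.hom = 0 := by
    simpa using hg =≫ rY.r
  refine ⟨⟨Z, hZ⟩, P.homMk (g ≫ rX.r), ?_, fun W h hh => ?_, fun V z hz' => ?_⟩
  · ext
    simpa using hgf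
  · have hh' : h.hom ≫ f.hom = 0 := congr(($hh).hom)
    obtain ⟨l, hl⟩ := hl W.property (h.hom ≫ rX.i) (by
      rw [Category.assoc, hf, reassoc_of% hh', zero_comp])
    refine ⟨P.homMk l, ?_⟩
    ext
    simp [reassoc_of% hl]
  · have hz'' : ∀ ⦃W : T⦄, P W → ∀ b : W ⟶ Z, b ≫ g ≫ rX.r = 0 → b ≫ z.hom = 0 :=
      fun W hW b hb => congr(($(hz' (W := ⟨W, hW⟩) (P.homMk b) (by ext; exact hb))).hom)
    obtain ⟨x, hx⟩ := hz z.hom fun W hW b hb => hz'' hW b (by rw [reassoc_of% hb, zero_comp])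
    -- The endomorphism `e` of `Z` lifts the idempotent of `X'` that splits off `X`. Since `𝟙 - e`
    -- is killed by `g ≫ rX.r`, it is killed by `z`, so `z = e ≫ z`; this moves the factorization of
    -- `z` from `X'` to `X`.
    obtain ⟨e, he⟩ := hl hZ (g ≫ rX.r ≫ rX.i) (by
      simp only [Category.assoc, hf]
      rw [reassoc_of% hgf, zero_comp])
    have h₁ := hz'' hZ (𝟙 _ - e) (by
      rw [Preadditive.sub_comp, reassoc_of% he]
      simp)
    rw [Preadditive.sub_comp, Category.id_comp, sub_eq_zero, ← hx, reassoc_of% he, hx] at h₁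
    refine ⟨P.homMk (rX.i ≫ x), ?_⟩
    ext
    simpa using h₁.symm

lemma hasInjectiveWeakKernels_op (hGP : G ≤ P)
    (hPG : ∀ X, P X → ∃ (X' : T) (_ : G X'), Nonempty (Retract X X'))
    (hR : ∀ Tr ∈ distTriang T, G Tr.obj₁ → G Tr.obj₂ → HasLeftResolution P Tr.obj₃) :
    LinearCat.HasInjectiveWeakKernels P.FullSubcategoryᵒᵖ := by
  rintro ⟨Y⟩ ⟨X⟩ f
  obtain ⟨f, rfl⟩ : ∃ f', f = Quiver.Hom.op f' := ⟨f.unop, rfl⟩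
  obtain ⟨X', hX', ⟨rX⟩⟩ := hPG _ X.property
  obtain ⟨Y', hY', ⟨rY⟩⟩ := hPG _ Y.property
  obtain ⟨K, κ, δ, hT⟩ := distinguished_cocone_triangle (rX.r ≫ f.hom ≫ rY.i)
  obtain ⟨Z, hZ, g, hg, hl, hz⟩ := exists_injective_weakCokernel (hGP _ hX') hT (hR _ hT hX' hY')
  have hf : (rX.r ≫ f.hom ≫ rY.i) ≫ rY.r = rX.r ≫ f.hom := by simp
  have hgf : f.hom ≫ rY.i ≫ g = 0 := by
    simpa using rX.i ≫= hg
  refine ⟨op ⟨Z, hZ⟩, (P.homMk (rY.i ≫ g)).op, ?_, ?_, ?_⟩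
  · apply Quiver.Hom.unop_inj
    ext
    simpa using hgf
  · rintro ⟨W⟩ h hh
    obtain ⟨h, rfl⟩ : ∃ h', h = Quiver.Hom.op h' := ⟨h.unop, rfl⟩
    have hh' : f.hom ≫ h.hom = 0 := congr(($hh).unop.hom)
    obtain ⟨l, hl⟩ := hl W.property (rY.r ≫ h.hom) (by
      rw [← Category.assoc, hf, Category.assoc, hh', comp_zero])
    refine ⟨(P.homMk l).op, ?_⟩
    apply Quiver.Hom.unop_inj
    ext
    change (rY.i ≫ g) ≫ l = h.hom
    simp [hl]
  · rintro ⟨V⟩ z hz'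
    obtain ⟨z, rfl⟩ : ∃ z', z = Quiver.Hom.op z' := ⟨z.unop, rfl⟩
    have hz'' : ∀ ⦃W : T⦄, P W → ∀ b : Z ⟶ W, (rY.i ≫ g) ≫ b = 0 → z.hom ≫ b = 0 :=
      fun W hW b hb => congr_arg (fun t => t.unop.hom) (hz' (W := op ⟨W, hW⟩) (P.homMk b).op
        (Quiver.Hom.unop_inj (by ext; exact hb)))
    obtain ⟨x, hx⟩ := hz z.hom fun W hW b hb => hz'' hW b (by rw [Category.assoc, hb, comp_zero])
    obtain ⟨e, he⟩ := hl hZ (rY.r ≫ rY.i ≫ g) (by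
      rw [← Category.assoc, hf, Category.assoc, hgf, comp_zero])
    have h₁ := hz'' hZ (𝟙 _ - e) (by
      rw [Preadditive.comp_sub, Category.comp_id, Category.assoc, he]
      simp)
    rw [Preadditive.comp_sub, Category.comp_id, sub_eq_zero, ← hx, Category.assoc, he] at h₁
    refine ⟨(P.homMk (x ≫ rY.r)).op, ?_⟩
    apply Quiver.Hom.unop_inj
    ext
    change (x ≫ rY.r) ≫ rY.i ≫ g = z.hom
    rw [← hx, h₁]
    simp

end TriangulatedResolution

/-! ## Duals of representable functors restricted to a subcategory -/

namespace LinearCat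

open Pretriangulated PresentedObjects ZeroObject

/-- A decomposition `∑ a j ≫ b j = 𝟙 X` presents `X` as a retract of `⨁ S`. It encodes finite sums
and summands at once and is preserved by additive functors, so it is the form used throughout. -/
lemma prop_of_sum_eq_id {T : Type*} [Category* T] [Preadditive T] [HasFiniteBiproducts T]
    (Q : ObjectProperty T) [Q.IsStableUnderRetracts] [Q.IsClosedUnderFiniteProducts]
    {J : Type} [Fintype J] {X : T} (S : J → T) (hS : ∀ j, Q (S j)) (a : ∀ j, X ⟶ S j)
    (b : ∀ j, S j ⟶ X) (h : ∑ j, a j ≫ b j = 𝟙 X) : Q X := by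
  have r : Retract X (⨁ S) :=
    { i := biproduct.lift a
      r := biproduct.desc b
      retract := by rw [biproduct.lift_desc, h] }
  exact Q.prop_of_retract r (Q.prop_of_isLimit_fan (biproduct.isLimit S) hS)

section

variable (k : Type u) [Field k] {T : Type v₁} [Category.{max u w} T] [Preadditive T] [Linear k T]
  (P : ObjectProperty T)

/-- The functor `X ↦ D T(X,-)`, restricted to the objects which satisfy `P`. -/
def dualCoyoneda : T ⥤ (P.FullSubcategoryᵒᵖ ⥤ ModuleCat.{max u w} k) :=
  (linearCoyoneda k T ⋙ (Functor.whiskeringLeft _ _ _).obj P.ι).rightOp ⋙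
    dualLeft.{w} k P.FullSubcategory

/-- The functor `X ↦ D T(-,X)`, restricted to the objects which satisfy `P`. -/
def dualYoneda : Tᵒᵖ ⥤ (P.FullSubcategory ⥤ ModuleCat.{max u w} k) :=
  (linearYoneda k T ⋙ (Functor.whiskeringLeft _ _ _).obj P.ι.op).op ⋙
    dualRight.{w} k P.FullSubcategory

variable {P}

lemma hasLifts_dualCoyoneda (X : T) :
    HasLifts (linearYoneda k P.FullSubcategory).obj ((dualCoyoneda.{w} k P).obj X) := by
  refine hasLifts_right.{w} _ (fun Y Z f g => ?_) (fun Y Z c f => ?_)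
  · ext φ
    change Module.Dual k (X ⟶ Z.obj) at φ
    refine LinearMap.ext fun (x : X ⟶ Y.obj) => ?_
    exact (congr_arg φ (Preadditive.comp_add _ _ _ x f.hom g.hom)).trans (φ.map_add _ _)
  · ext φ
    change Module.Dual k (X ⟶ Z.obj) at φ
    refine LinearMap.ext fun (x : X ⟶ Y.obj) => ?_
    exact (congr_arg φ (Linear.comp_smul _ _ _ x c f.hom)).trans (φ.map_smul _ _)

lemma hasLifts_dualYoneda (X : T) :
    HasLifts (fun A : P.FullSubcategory => (linearCoyoneda k P.FullSubcategory).obj (op A))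
      ((dualYoneda.{w} k P).obj (op X)) := by
  refine hasLifts_left.{w} _ (fun Y Z f g => ?_) (fun Y Z c f => ?_)
  · ext φ
    change Module.Dual k (Y.obj ⟶ X) at φ
    refine LinearMap.ext fun (x : Z.obj ⟶ X) => ?_
    exact (congr_arg φ (Preadditive.add_comp _ _ _ f.hom g.hom x)).trans (φ.map_add _ _)
  · ext φ
    change Module.Dual k (Y.obj ⟶ X) at φ
    refine LinearMap.ext fun (x : Z.obj ⟶ X) => ?_
    exact (congr_arg φ (Linear.smul_comp _ _ _ c f.hom x)).trans (φ.map_smul _ _)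

/-- The functor `D U(A,-)` on the full subcategory `U` is the restriction of `D T(A,-)`. -/
def dualCoyonedaIso (A : P.FullSubcategory) : (dualCoyoneda.{w} k P).obj A.obj ≅
    (dualLeft.{w} k P.FullSubcategory).obj (op ((linearCoyoneda k P.FullSubcategory).obj (op A))) :=
  (dualLeft.{w} k P.FullSubcategory).mapIso (Iso.op (NatIso.ofComponents
    (fun _ => (InducedCategory.homLinearEquiv (R := k)).toModuleIso) (fun _ => rfl)))

/-- The functor `D U(-,A)` on the full subcategory `U` is the restriction of `D T(-,A)`. -/
def dualYonedaIso (A : P.FullSubcategory) : (dualYoneda.{w} k P).obj (op A.obj) ≅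
    (dualRight.{w} k P.FullSubcategory).obj (op ((linearYoneda k P.FullSubcategory).obj A)) :=
  (dualRight.{w} k P.FullSubcategory).mapIso (Iso.op (NatIso.ofComponents
    (fun _ => (InducedCategory.homLinearEquiv (R := k)).toModuleIso) (fun _ => rfl)))

lemma isZero_dualCoyoneda {X : T} (hX : IsZero X) : IsZero ((dualCoyoneda.{w} k P).obj X) := by
  rw [Functor.isZero_iff]
  intro Y
  have : Subsingleton (X ⟶ Y.unop.obj) := ⟨fun f g => hX.eq_of_src f g⟩
  exact ModuleCat.isZero_of_iff_subsingleton.2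
    (inferInstanceAs (Subsingleton (Module.Dual k (X ⟶ Y.unop.obj))))

lemma isZero_dualYoneda {X : T} (hX : IsZero X) : IsZero ((dualYoneda.{w} k P).obj (op X)) := by
  rw [Functor.isZero_iff]
  intro Y
  have : Subsingleton (Y.obj ⟶ X) := ⟨fun f g => hX.eq_of_tgt f g⟩
  exact ModuleCat.isZero_of_iff_subsingleton.2
    (inferInstanceAs (Subsingleton (Module.Dual k (Y.obj ⟶ X))))

variable [HasZeroObject T] [HasShift T ℤ] [∀ n : ℤ, (shiftFunctor T n).Additive] [Pretriangulated T]

/-- `T(-,U)` is cohomological and `D` is exact, so `X ↦ D T(X,-)` is homological. -/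
lemma dualCoyoneda_exact (Tr : Triangle T) (hTr : Tr ∈ distTriang T) :
    ∃ z : (dualCoyoneda.{w} k P).map Tr.mor₁ ≫ (dualCoyoneda.{w} k P).map Tr.mor₂ = 0,
      (ShortComplex.mk _ _ z).Exact := by
  have h₀ : Tr.mor₁ ≫ Tr.mor₂ = 0 := comp_distTriang_mor_zero₁₂ _ hTr
  have h : ∃ z : ((linearCoyoneda k T ⋙ (Functor.whiskeringLeft _ _ _).obj P.ι).map Tr.mor₂.op) ≫
      ((linearCoyoneda k T ⋙ (Functor.whiskeringLeft _ _ _).obj P.ι).map Tr.mor₁.op) = 0,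
        (ShortComplex.mk _ _ z).Exact := by
    have z : ((linearCoyoneda k T ⋙ (Functor.whiskeringLeft _ _ _).obj P.ι).map Tr.mor₂.op) ≫
      ((linearCoyoneda k T ⋙ (Functor.whiskeringLeft _ _ _).obj P.ι).map Tr.mor₁.op) = 0 := by
      ext X (x : Tr.obj₃ ⟶ X.obj)
      change Tr.mor₁ ≫ Tr.mor₂ ≫ x = 0
      rw [reassoc_of% h₀, zero_comp]
    refine ⟨z, functor_exact_iff.2 fun X (x : Tr.obj₂ ⟶ X.obj) => ⟨fun hx => ?_, ?_⟩⟩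
    · obtain ⟨y, hy⟩ := Triangle.yoneda_exact₂ _ hTr x hx
      exact ⟨y, hy.symm⟩
    · rintro ⟨y, rfl⟩
      exact congr(($z).app X y)
  obtain ⟨z, hz⟩ := h
  exact dualLeft_exact _ _ z hz

lemma dualYoneda_exact (Tr : Triangle T) (hTr : Tr ∈ distTriang T) :
    ∃ z : (dualYoneda.{w} k P).map Tr.mor₂.op ≫ (dualYoneda.{w} k P).map Tr.mor₁.op = 0,
      (ShortComplex.mk _ _ z).Exact := by
  have h₀ : Tr.mor₁ ≫ Tr.mor₂ = 0 := comp_distTriang_mor_zero₁₂ _ hTr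
  have h : ∃ z : ((linearYoneda k T ⋙ (Functor.whiskeringLeft _ _ _).obj P.ι.op).map Tr.mor₁) ≫
      ((linearYoneda k T ⋙ (Functor.whiskeringLeft _ _ _).obj P.ι.op).map Tr.mor₂) = 0,
        (ShortComplex.mk _ _ z).Exact := by
    have z : ((linearYoneda k T ⋙ (Functor.whiskeringLeft _ _ _).obj P.ι.op).map Tr.mor₁) ≫
      ((linearYoneda k T ⋙ (Functor.whiskeringLeft _ _ _).obj P.ι.op).map Tr.mor₂) = 0 := by
      ext X (x : X.unop.obj ⟶ Tr.obj₁)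
      change (x ≫ Tr.mor₁) ≫ Tr.mor₂ = 0
      rw [Category.assoc, h₀, comp_zero]
    refine ⟨z, functor_exact_iff.2 fun X (x : X.unop.obj ⟶ Tr.obj₂) => ⟨fun hx => ?_, ?_⟩⟩
    · obtain ⟨y, hy⟩ := Triangle.coyoneda_exact₂ _ hTr x hx
      exact ⟨y, hy.symm⟩
    · rintro ⟨y, rfl⟩
      exact congr(($z).app X y)
  obtain ⟨z, hz⟩ := h
  exact dualRight_exact _ _ z hz

variable (P) in
/-- The objects `X` such that the restrictions to `P` of the functors `D T(X⟦n⟧,-)` are finitely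
presented. -/
def fpDualCoyoneda : ObjectProperty T := fun X =>
  ∀ n : ℤ, fpRight.{w} k P.FullSubcategory ((dualCoyoneda.{w} k P).obj (X⟦n⟧))

variable (P) in
/-- The objects `X` such that the restrictions to `P` of the functors `D T(-,X⟦n⟧)` are finitely
presented. -/
def fpDualYoneda : ObjectProperty T := fun X =>
  ∀ n : ℤ, fpLeft.{w} k P.FullSubcategory ((dualYoneda.{w} k P).obj (op (X⟦n⟧)))

variable [HasZeroObject P.FullSubcategory] [HasBinaryBiproducts P.FullSubcategory]

omit [HasZeroObject T] [∀ n : ℤ, (shiftFunctor T n).Additive] [Pretriangulated T] in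
lemma fpDualCoyoneda_isStableUnderRetracts
    (hP : HasInjectiveWeakKernels P.FullSubcategory) :
    (fpDualCoyoneda.{w} k P).IsStableUnderRetracts where
  of_retract r h n := (isCoherentFamily_right.{w} k hP).fp_of_retract
    ((r.map (shiftFunctor T n)).map (dualCoyoneda.{w} k P)) (h n)

omit [HasZeroObject T] [∀ n : ℤ, (shiftFunctor T n).Additive] [Pretriangulated T] in
lemma fpDualYoneda_isStableUnderRetracts
    (hP : HasInjectiveWeakKernels P.FullSubcategoryᵒᵖ) :
    (fpDualYoneda.{w} k P).IsStableUnderRetracts where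
  of_retract r h n := (isCoherentFamily_left.{w} k hP).fp_of_retract
    ((r.map (shiftFunctor T n)).op.map (dualYoneda.{w} k P)) (h n)

/-- A triangle gives a five-term exact sequence whose outer terms involve the shifts of `Tr.obj₃` by
`n - 1` and of `Tr.obj₁` by `n + 1`; hence the quantification over all shifts in `fpDualCoyoneda`.
Linearity of `D T(X,-)` provides the lifting property of the middle term. -/
lemma fpDualCoyoneda_isTriangulated
    (hP : HasInjectiveWeakKernels P.FullSubcategory) :
    (fpDualCoyoneda.{w} k P).IsTriangulated := by
  have hp := isCoherentFamily_right.{w} k hP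
  have := fpDualCoyoneda_isStableUnderRetracts.{w} k hP
  have iso {X Y : T} (e : X ≅ Y) (h : fpRight.{w} k P.FullSubcategory
      ((dualCoyoneda.{w} k P).obj X)) : fpRight.{w} k P.FullSubcategory
      ((dualCoyoneda.{w} k P).obj Y) :=
    (fp _).prop_of_iso ((dualCoyoneda.{w} k P).mapIso e) h
  have : (fpDualCoyoneda.{w} k P).IsTriangulatedClosed₂ := .mk' fun Tr hTr h₁ h₃ n => by
    have hTr' := Triangle.shift_distinguished _ hTr n
    obtain ⟨z₁, e₁⟩ := dualCoyoneda_exact.{w} k (P := P) _ (inv_rot_of_distTriang _ hTr')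
    obtain ⟨z₂, e₂⟩ := dualCoyoneda_exact.{w} k (P := P) _ hTr'
    obtain ⟨z₃, e₃⟩ := dualCoyoneda_exact.{w} k (P := P) _ (rot_of_distTriang _ hTr')
    exact hp.fp_of_exact₅
      (iso ((shiftFunctorAdd' T n (-1) (n + -1) rfl).app Tr.obj₃) (h₃ (n + -1)))
      (h₁ n) (h₃ n) (iso ((shiftFunctorAdd' T n 1 (n + 1) rfl).app Tr.obj₁) (h₁ (n + 1)))
      (hasLifts_dualCoyoneda.{w} k _) _ _ _ _ z₁ z₂ z₃ e₁ e₂ e₃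
  exact
    { exists_zero := ⟨0, isZero_zero T, fun n => by
        have := hp.containsZero
        exact (fp _).prop_of_isZero
          (isZero_dualCoyoneda.{w} k ((shiftFunctor T n).map_isZero (isZero_zero T)))⟩
      isStableUnderShiftBy := fun m => ⟨fun X hX n =>
        iso ((shiftFunctorAdd' T m n (m + n) rfl).app X) (hX (m + n))⟩
      ext₂' := this.ext₂' }

lemma fpDualYoneda_isTriangulated
    (hP : HasInjectiveWeakKernels P.FullSubcategoryᵒᵖ) :
    (fpDualYoneda.{w} k P).IsTriangulated := by
  have hp := isCoherentFamily_left.{w} k hP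
  have := fpDualYoneda_isStableUnderRetracts.{w} k hP
  have iso {X Y : T} (e : X ≅ Y) (h : fpLeft.{w} k P.FullSubcategory
      ((dualYoneda.{w} k P).obj (op X))) : fpLeft.{w} k P.FullSubcategory
      ((dualYoneda.{w} k P).obj (op Y)) :=
    (fp _).prop_of_iso ((dualYoneda.{w} k P).mapIso e.symm.op) h
  have : (fpDualYoneda.{w} k P).IsTriangulatedClosed₂ := .mk' fun Tr hTr h₁ h₃ n => by
    have hTr' := Triangle.shift_distinguished _ hTr n
    obtain ⟨z₁, e₁⟩ := dualYoneda_exact.{w} k (P := P) _ (inv_rot_of_distTriang _ hTr')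
    obtain ⟨z₂, e₂⟩ := dualYoneda_exact.{w} k (P := P) _ hTr'
    obtain ⟨z₃, e₃⟩ := dualYoneda_exact.{w} k (P := P) _ (rot_of_distTriang _ hTr')
    exact hp.fp_of_exact₅
      (iso ((shiftFunctorAdd' T n 1 (n + 1) rfl).app Tr.obj₁) (h₁ (n + 1)))
      (h₃ n) (h₁ n) (iso ((shiftFunctorAdd' T n (-1) (n + -1) rfl).app Tr.obj₃) (h₃ (n + -1)))
      (hasLifts_dualYoneda.{w} k _) _ _ _ _ z₃ z₂ z₁ e₃ e₂ e₁
  exact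
    { exists_zero := ⟨0, isZero_zero T, fun n => by
        have := hp.containsZero
        exact (fp _).prop_of_isZero
          (isZero_dualYoneda.{w} k ((shiftFunctor T n).map_isZero (isZero_zero T)))⟩
      isStableUnderShiftBy := fun m => ⟨fun X hX n =>
        iso ((shiftFunctorAdd' T m n (m + n) rfl).app X) (hX (m + n))⟩
      ext₂' := this.ext₂' }

end

end LinearCat

/-! ## Direct summands of sums of shifts of objects in the derived category -/

namespace DerivedCategory

open Pretriangulated ZeroObject HomologicalComplex

variable (𝒜 : Type*) [Category* 𝒜] [Abelian 𝒜] [HasDerivedCategory.{w} 𝒜]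

/-- The direct summands of the finite direct sums of complexes which are concentrated in a single
degree. -/
def sumsOfSingles : ObjectProperty (DerivedCategory 𝒜) := fun X =>
  ∃ (J : Type) (_ : Fintype J) (A : J → 𝒜) (i : J → ℤ)
    (a : ∀ j, X ⟶ (singleFunctor 𝒜 (i j)).obj (A j))
    (b : ∀ j, (singleFunctor 𝒜 (i j)).obj (A j) ⟶ X), ∑ j, a j ≫ b j = 𝟙 X

variable {𝒜}

lemma sumsOfSingles_single (A : 𝒜) (i : ℤ) : sumsOfSingles 𝒜 ((singleFunctor 𝒜 i).obj A) :=
  ⟨Unit, inferInstance, fun _ => A, fun _ => i, fun _ => 𝟙 _, fun _ => 𝟙 _, by simp⟩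

lemma sumsOfSingles_of_sum {X : DerivedCategory 𝒜} {J : Type} [Fintype J]
    (S : J → DerivedCategory 𝒜) (hS : ∀ j, sumsOfSingles 𝒜 (S j)) (a : ∀ j, X ⟶ S j)
    (b : ∀ j, S j ⟶ X) (h : ∑ j, a j ≫ b j = 𝟙 X) : sumsOfSingles 𝒜 X := by
  choose K hK A i f g hfg using hS
  refine ⟨Σ j, K j, inferInstance, fun p => A p.1 p.2, fun p => i p.1 p.2,
    fun p => a p.1 ≫ f p.1 p.2, fun p => g p.1 p.2 ≫ b p.1, ?_⟩
  rw [Fintype.sum_sigma, ← h]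
  refine Finset.sum_congr rfl fun j _ => ?_
  have := a j ≫= hfg j =≫ b j
  simpa [Preadditive.comp_sum, Preadditive.sum_comp] using this

instance : (sumsOfSingles 𝒜).IsStableUnderRetracts where
  of_retract r h := sumsOfSingles_of_sum (J := Unit) (fun _ => _) (fun _ => h) (fun _ => r.i)
    (fun _ => r.r) (by simp)

instance : (sumsOfSingles 𝒜).ContainsZero where
  exists_zero := ⟨0, isZero_zero _, Empty, inferInstance, Empty.elim, Empty.elim, fun j => j.elim,
    fun j => j.elim, (isZero_zero _).eq_of_src _ _⟩

instance : (sumsOfSingles 𝒜).IsStableUnderShift ℤ where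
  isStableUnderShiftBy m := ⟨by
    rintro X ⟨J, _, A, i, a, b, h⟩
    have e (j : J) := ((singleFunctors 𝒜).shiftIso m (i j - m) (i j) (by lia)).app (A j)
    refine ⟨J, inferInstance, A, fun j => i j - m, fun j => (a j)⟦m⟧' ≫ (e j).hom,
      fun j => (e j).inv ≫ (b j)⟦m⟧', ?_⟩
    have := congr_arg (fun f => f⟦m⟧') h
    simpa [Functor.map_sum] using this⟩

lemma sumsOfSingles_biprod {X Y : DerivedCategory 𝒜} (hX : sumsOfSingles 𝒜 X)
    (hY : sumsOfSingles 𝒜 Y) : sumsOfSingles 𝒜 (X ⊞ Y) :=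
  sumsOfSingles_of_sum (J := Bool) (fun j => if j then X else Y)
    (by rintro (_ | _) <;> assumption)
    (fun | true => biprod.fst | false => biprod.snd)
    (fun | true => biprod.inl | false => biprod.inr)
    ((Fintype.sum_bool _).trans biprod.total)

/-- With zero differential, the inclusions and projections of the terms are chain maps; the bounds
make the resulting decomposition of the identity finite. -/
lemma sumsOfSingles_of_d_eq_zero (K : CochainComplex 𝒜 ℤ) (a b : ℤ) [K.IsStrictlyGE a]
    [K.IsStrictlyLE b] (hK : ∀ i j, K.d i j = 0) : sumsOfSingles 𝒜 (Q.obj K) := by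
  let f (n : ℤ) : K ⟶ (single 𝒜 (.up ℤ) n).obj (K.X n) :=
    mkHomToSingle (𝟙 _) (fun i _ => by simp [hK])
  let g (n : ℤ) : (single 𝒜 (.up ℤ) n).obj (K.X n) ⟶ K :=
    mkHomFromSingle (𝟙 _) (fun i _ => by simp [hK])
  have h₁ (n : ℤ) : (f n ≫ g n).f n = 𝟙 _ := by
    rw [comp_f, mkHomToSingle_f, mkHomFromSingle_f]
    simp
  have h₂ (n m : ℤ) (h : m ≠ n) : (f n ≫ g n).f m = 0 :=
    (isZero_single_obj_X (.up ℤ) n (K.X n) m h).eq_of_tgt ((f n).f m) 0 =≫ (g n).f m |>.trans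
      zero_comp
  have hsum : ∑ n : Finset.Icc a b, f n ≫ g n = 𝟙 K := by
    ext m
    refine ((eval 𝒜 _ m).map_sum _ _).trans ?_
    by_cases hm : m ∈ Finset.Icc a b
    · exact (Finset.sum_eq_single ⟨m, hm⟩ (fun n _ hn => h₂ _ _ fun h => hn (Subtype.ext h.symm))
        (fun h => (h (Finset.mem_univ _)).elim)).trans (h₁ m)
    · refine IsZero.eq_of_src ?_ _ _
      rw [Finset.mem_Icc, not_and_or, not_le, not_le] at hm
      obtain hm | hm := hm
      · exact K.isZero_of_isStrictlyGE a m hm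
      · exact K.isZero_of_isStrictlyLE b m hm
  refine ⟨Finset.Icc a b, inferInstance, fun n => K.X n, fun n => n, fun n => Q.map (f n),
    fun n => Q.map (g n), ?_⟩
  refine (Finset.sum_congr rfl fun n _ => (Q.map_comp (f n.1) (g n.1)).symm).trans ?_
  rw [← Functor.map_sum, hsum, Q.map_id]

/-! ### Bounded complexes -/

variable (R : ObjectProperty 𝒜)

/-- The objects of the derived category which are isomorphic to bounded complexes with terms
in `R`. -/
def boundedComplexes : ObjectProperty (DerivedCategory 𝒜) := fun X =>
  ∃ (K : CochainComplex 𝒜 ℤ) (a b : ℤ) (_ : K.IsStrictlyGE a) (_ : K.IsStrictlyLE b)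
    (_ : ∀ n, R (K.X n)), Nonempty (Q.obj K ≅ X)

instance : (boundedComplexes R).IsClosedUnderIsomorphisms where
  of_iso e := by
    rintro ⟨K, a, b, ha, hb, hK, ⟨e'⟩⟩
    exact ⟨K, a, b, ha, hb, hK, ⟨e' ≪≫ e⟩⟩

variable {R}

lemma boundedComplexes_single [R.ContainsZero] [R.IsClosedUnderIsomorphisms] {A : 𝒜} (hA : R A)
    (n : ℤ) : boundedComplexes R ((singleFunctor 𝒜 n).obj A) := by
  refine ⟨(CochainComplex.singleFunctor 𝒜 n).obj A, n, n, inferInstance, inferInstance,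
    fun m => ?_, ⟨((singleFunctorIsoCompQ 𝒜 n).app A).symm⟩⟩
  by_cases h : m = n
  · exact R.prop_of_iso (singleObjXIsoOfEq (.up ℤ) n A m h).symm hA
  · exact R.prop_of_isZero (isZero_single_obj_X (.up ℤ) n A m h)

/-- If the morphisms between bounded complexes with terms in `R` are given by morphisms of
complexes, then these complexes form a triangulated subcategory. -/
lemma boundedComplexes_isTriangulated [R.ContainsZero] [R.IsClosedUnderIsomorphisms]
    (hbiprod : ∀ A B, R A → R B → R (A ⊞ B))
    (hlift : ∀ (K L : CochainComplex 𝒜 ℤ) (a b a' b' : ℤ) [K.IsStrictlyGE a] [K.IsStrictlyLE b]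
      [L.IsStrictlyGE a'] [L.IsStrictlyLE b'], (∀ n, R (K.X n)) → (∀ n, R (L.X n)) →
        ∀ f : Q.obj K ⟶ Q.obj L, ∃ φ : K ⟶ L, Q.map φ = f) :
    (boundedComplexes R).IsTriangulated := by
  have hshift : (boundedComplexes R).IsStableUnderShift ℤ :=
    { isStableUnderShiftBy := fun m => ⟨by
        rintro X ⟨K, a, b, _, _, hK, ⟨e⟩⟩
        exact ⟨K⟦m⟧, a - m, b - m, K.isStrictlyGE_shift a m _ (by lia),
          K.isStrictlyLE_shift b m _ (by lia), fun n => hK (n + m),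
          ⟨(Q.commShiftIso m).app K ≪≫ (shiftFunctor _ m).mapIso e⟩⟩⟩ }
  have hcone : (boundedComplexes R).IsTriangulatedClosed₃ := .mk' fun Tr hTr => by
    rintro ⟨K, a, b, _, _, hK, ⟨e⟩⟩ ⟨L, a', b', _, _, hL, ⟨e'⟩⟩
    -- Once the morphism is a chain map, the third object of the triangle is its mapping cone, with
    -- terms `K.X (n + 1) ⊞ L.X n`; this accounts for `a - 1` and `b - 1` in the bounds.
    obtain ⟨φ, hφ⟩ := hlift K L a b a' b' hK hL (e.hom ≫ Tr.mor₁ ≫ e'.inv)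
    have i := isoTriangleOfIso₁₂ _ _ (mappingCone_triangle_distinguished φ) hTr e e' (by
      change Q.map φ ≫ e'.hom = _
      rw [hφ]
      simp
      rfl)
    refine ⟨CochainComplex.mappingCone φ, min (a - 1) a', max (b - 1) b', ?_, ?_, fun n => ?_,
      ⟨Triangle.π₃.mapIso i⟩⟩
    · rw [CochainComplex.isStrictlyGE_iff]
      intro n hn
      rw [CochainComplex.mappingCone.isZero_X_iff]
      exact ⟨K.isZero_of_isStrictlyGE a _, L.isZero_of_isStrictlyGE a' _⟩
    · rw [CochainComplex.isStrictlyLE_iff]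
      intro n hn
      rw [CochainComplex.mappingCone.isZero_X_iff]
      exact ⟨K.isZero_of_isStrictlyLE b _, L.isZero_of_isStrictlyLE b' _⟩
    · exact R.prop_of_iso (homotopyCofiber.XIsoBiprod φ n (n + 1) rfl).symm
        (hbiprod _ _ (hK _) (hL _))
  have := ObjectProperty.IsTriangulatedClosed₂.of_isTriangulatedClosed₃ (P := boundedComplexes R)
  exact
    { exists_zero := by
        obtain ⟨Z, hZ, hZ'⟩ := R.exists_prop_of_containsZero
        exact ⟨_, (singleFunctor 𝒜 0).map_isZero hZ, boundedComplexes_single hZ' 0⟩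
      ext₂' := this.ext₂' }

/-- Maps into a K-injective complex agree in the homotopy and derived categories, and homotopy
classes have representatives. -/
lemma exists_map_eq_of_isKInjective {K L : CochainComplex 𝒜 ℤ} [L.IsKInjective]
    (f : Q.obj K ⟶ Q.obj L) : ∃ φ : K ⟶ L, Q.map φ = f := by
  obtain ⟨g, hg⟩ := (CochainComplex.IsKInjective.Qh_map_bijective _ _).surjective
    ((quotientCompQhIso 𝒜).hom.app K ≫ f ≫ (quotientCompQhIso 𝒜).inv.app L)
  obtain ⟨φ, rfl⟩ := (HomotopyCategory.quotient _ _).map_surjective g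
  refine ⟨φ, ?_⟩
  have := quotientCompQhIso_hom_naturality φ
  rw [hg] at this
  simpa using this.symm

lemma exists_map_eq_of_isKProjective {K L : CochainComplex 𝒜 ℤ} [K.IsKProjective]
    (f : Q.obj K ⟶ Q.obj L) : ∃ φ : K ⟶ L, Q.map φ = f := by
  obtain ⟨g, hg⟩ := (CochainComplex.IsKProjective.Qh_map_bijective _ _).surjective
    ((quotientCompQhIso 𝒜).hom.app K ≫ f ≫ (quotientCompQhIso 𝒜).inv.app L)
  obtain ⟨φ, rfl⟩ := (HomotopyCategory.quotient _ _).map_surjective g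
  refine ⟨φ, ?_⟩
  have := quotientCompQhIso_hom_naturality φ
  rw [hg] at this
  simpa using this.symm

/-! ### Resolutions of bounded complexes of injective or projective objects -/

open TriangulatedResolution

/-- The triangle is that of `0 ⟶ cycles ⟶ K ⟶ K / cycles ⟶ 0`, with zero differentials on both ends.
K-injectivity turns a map from an object in one degree into a chain map, which must land in the
cycles and so dies in the quotient. -/
lemma hasRightResolution_of_isKInjective (K : CochainComplex 𝒜 ℤ) [K.IsKInjective] (a b : ℤ)
    [K.IsStrictlyGE a] [K.IsStrictlyLE b] : HasRightResolution (sumsOfSingles 𝒜) (Q.obj K) := by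
  let Z : CochainComplex 𝒜 ℤ := { X := fun n => K.cycles n, d := 0 }
  let B : CochainComplex 𝒜 ℤ := { X := fun n => cokernel (K.iCycles n), d := 0 }
  have : Z.IsStrictlyGE a := by
    rw [CochainComplex.isStrictlyGE_iff]
    exact fun n hn => (K.isZero_of_isStrictlyGE a n hn).of_mono (K.iCycles n)
  have : Z.IsStrictlyLE b := by
    rw [CochainComplex.isStrictlyLE_iff]
    exact fun n hn => (K.isZero_of_isStrictlyLE b n hn).of_mono (K.iCycles n)
  have : B.IsStrictlyGE a := by
    rw [CochainComplex.isStrictlyGE_iff]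
    exact fun n hn => (K.isZero_of_isStrictlyGE a n hn).of_epi (cokernel.π (K.iCycles n))
  have : B.IsStrictlyLE b := by
    rw [CochainComplex.isStrictlyLE_iff]
    exact fun n hn => (K.isZero_of_isStrictlyLE b n hn).of_epi (cokernel.π (K.iCycles n))
  let f : Z ⟶ K :=
    { f := fun n => K.iCycles n
      comm' := fun i j _ => (K.iCycles_d i j).trans zero_comp.symm }
  let g : K ⟶ B :=
    { f := fun n => cokernel.π (K.iCycles n)
      comm' := fun i j hij => by
        refine comp_zero.trans (Eq.symm ?_)
        rw [← K.toCycles_i i j, Category.assoc, cokernel.condition, comp_zero] }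
  let S : ShortComplex (CochainComplex 𝒜 ℤ) :=
    ShortComplex.mk f g (by ext n; exact cokernel.condition (K.iCycles n))
  have hS : S.ShortExact := shortExact_of_degreewise_shortExact _ fun n =>
    { exact := ShortComplex.exact_cokernel (K.iCycles n)
      mono_f := inferInstanceAs (Mono (K.iCycles n))
      epi_g := inferInstanceAs (Epi (cokernel.π (K.iCycles n))) }
  refine ⟨_, _, _, _, _, triangleOfSES_distinguished hS,
    sumsOfSingles_of_d_eq_zero Z a b (fun _ _ => rfl),
    sumsOfSingles_of_d_eq_zero B a b (fun _ _ => rfl), ?_⟩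
  have key (A : 𝒜) (n : ℤ) (v : Q.obj ((single 𝒜 (.up ℤ) n).obj A) ⟶ Q.obj K) :
      v ≫ Q.map g = 0 := by
    obtain ⟨φ, rfl⟩ := exists_map_eq_of_isKInjective v
    have : φ ≫ g = 0 := by
      refine from_single_hom_ext ?_
      have hφ : φ.f n ≫ K.d n (n + 1) = 0 := by rw [φ.comm]; simp
      rw [comp_f, ← K.liftCycles_i (φ.f n) (n + 1) (by simp) hφ, Category.assoc]
      exact (congr_arg _ (cokernel.condition (K.iCycles n))).trans comp_zero
    rw [← Functor.map_comp, this, Functor.map_zero]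
  rintro U ⟨J, _, A, i, α, β, h⟩ u
  have := h =≫ (u ≫ Q.map g)
  rw [Category.id_comp, Preadditive.sum_comp] at this
  refine this.symm.trans (Finset.sum_eq_zero fun j _ => ?_)
  have hj := key (A j) (i j) (β j ≫ u)
  exact (by simp : (α j ≫ β j) ≫ u ≫ Q.map g = α j ≫ (β j ≫ u) ≫ Q.map g).trans
    ((congr_arg _ hj).trans comp_zero)

/-- Dually, a chain map to a complex concentrated in one degree kills the boundaries, which form the
kernel of `K ⟶ opcycles`. -/
lemma hasLeftResolution_of_isKProjective (K : CochainComplex 𝒜 ℤ) [K.IsKProjective] (a b : ℤ)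
    [K.IsStrictlyGE a] [K.IsStrictlyLE b] : HasLeftResolution (sumsOfSingles 𝒜) (Q.obj K) := by
  let Z : CochainComplex 𝒜 ℤ := { X := fun n => K.opcycles n, d := 0 }
  let B : CochainComplex 𝒜 ℤ := { X := fun n => kernel (K.pOpcycles n), d := 0 }
  have : Z.IsStrictlyGE a := by
    rw [CochainComplex.isStrictlyGE_iff]
    exact fun n hn => (K.isZero_of_isStrictlyGE a n hn).of_epi (K.pOpcycles n)
  have : Z.IsStrictlyLE b := by
    rw [CochainComplex.isStrictlyLE_iff]
    exact fun n hn => (K.isZero_of_isStrictlyLE b n hn).of_epi (K.pOpcycles n)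
  have : B.IsStrictlyGE a := by
    rw [CochainComplex.isStrictlyGE_iff]
    exact fun n hn => (K.isZero_of_isStrictlyGE a n hn).of_mono (kernel.ι (K.pOpcycles n))
  have : B.IsStrictlyLE b := by
    rw [CochainComplex.isStrictlyLE_iff]
    exact fun n hn => (K.isZero_of_isStrictlyLE b n hn).of_mono (kernel.ι (K.pOpcycles n))
  let g : K ⟶ Z :=
    { f := fun n => K.pOpcycles n
      comm' := fun i j _ => comp_zero.trans (K.d_pOpcycles i j).symm }
  let f : B ⟶ K :=
    { f := fun n => kernel.ι (K.pOpcycles n)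
      comm' := fun i j hij => by
        refine Eq.trans ?_ zero_comp.symm
        rw [← K.p_fromOpcycles i j, kernel.condition_assoc, zero_comp] }
  let S : ShortComplex (CochainComplex 𝒜 ℤ) :=
    ShortComplex.mk f g (by ext n; exact kernel.condition (K.pOpcycles n))
  have hS : S.ShortExact := shortExact_of_degreewise_shortExact _ fun n =>
    { exact := ShortComplex.exact_kernel (K.pOpcycles n)
      mono_f := inferInstanceAs (Mono (kernel.ι (K.pOpcycles n)))
      epi_g := inferInstanceAs (Epi (K.pOpcycles n)) }
  refine ⟨_, _, _, _, _, triangleOfSES_distinguished hS,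
    sumsOfSingles_of_d_eq_zero Z a b (fun _ _ => rfl),
    sumsOfSingles_of_d_eq_zero B a b (fun _ _ => rfl), ?_⟩
  have key (A : 𝒜) (n : ℤ) (v : Q.obj K ⟶ Q.obj ((single 𝒜 (.up ℤ) n).obj A)) :
      Q.map f ≫ v = 0 := by
    obtain ⟨φ, rfl⟩ := exists_map_eq_of_isKProjective v
    have : f ≫ φ = 0 := by
      refine to_single_hom_ext ?_
      have hφ : K.d (n - 1) n ≫ φ.f n = 0 := by rw [← φ.comm]; simp
      rw [comp_f, ← K.p_descOpcycles (φ.f n) (n - 1) (by simp) hφ]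
      exact (Category.assoc _ _ _).symm.trans
        ((kernel.condition (K.pOpcycles n) =≫ _).trans zero_comp)
    rw [← Functor.map_comp, this, Functor.map_zero]
  rintro U ⟨J, _, A, i, α, β, h⟩ u
  have := (Q.map f ≫ u) ≫= h
  rw [Category.comp_id, Preadditive.comp_sum] at this
  refine this.symm.trans (Finset.sum_eq_zero fun j _ => ?_)
  have hj := key (A j) (i j) (u ≫ α j)
  exact (by simp : (Q.map f ≫ u) ≫ α j ≫ β j = (Q.map f ≫ u ≫ α j) ≫ β j).trans
    ((congr_arg (fun t => t ≫ β j) hj).trans zero_comp)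

/-! ### Dévissage -/

/-- Induction along cosyzygies: `A`, an injective hull object and the cokernel form a triangle. The
bound `d + 1` is strict, so `d = 0` is the injective case. -/
lemma prop_single_of_hasInjectiveDimensionLT [EnoughInjectives 𝒜]
    (P : ObjectProperty (DerivedCategory 𝒜)) [P.IsTriangulated] [P.IsClosedUnderIsomorphisms]
    (hP : ∀ I : 𝒜, Injective I → P ((singleFunctor 𝒜 0).obj I)) (d : ℕ) (A : 𝒜)
    [HasInjectiveDimensionLT A (d + 1)] : P ((singleFunctor 𝒜 0).obj A) := by
  induction d generalizing A with
  | zero => exact hP A (injective_iff_hasInjectiveDimensionLT_one |>.2 ‹_›)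
  | succ d hd =>
    have hS : (ShortComplex.mk _ _ (cokernel.condition (Injective.ι A))).ShortExact :=
      { exact := ShortComplex.exact_cokernel _ }
    have := (hS.hasInjectiveDimensionLT_X₃_iff d inferInstance).2 inferInstance
    exact P.ext_of_isTriangulatedClosed₁ _ hS.singleTriangle_distinguished (hP _ inferInstance)
      (hd (cokernel (Injective.ι A)))

lemma prop_single_of_hasProjectiveDimensionLT [EnoughProjectives 𝒜]
    (P : ObjectProperty (DerivedCategory 𝒜)) [P.IsTriangulated] [P.IsClosedUnderIsomorphisms]
    (hP : ∀ I : 𝒜, Projective I → P ((singleFunctor 𝒜 0).obj I)) (d : ℕ) (A : 𝒜)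
    [HasProjectiveDimensionLT A (d + 1)] : P ((singleFunctor 𝒜 0).obj A) := by
  induction d generalizing A with
  | zero => exact hP A (projective_iff_hasProjectiveDimensionLT_one |>.2 ‹_›)
  | succ d hd =>
    have hS : (ShortComplex.mk _ _ (kernel.condition (Projective.π A))).ShortExact :=
      { exact := ShortComplex.exact_kernel _ }
    have := (hS.hasProjectiveDimensionLT_X₃_iff d inferInstance).1 inferInstance
    exact P.ext_of_isTriangulatedClosed₃ _ hS.singleTriangle_distinguished
      (hd (kernel (Projective.π A))) (hP _ inferInstance)

lemma sumsOfSingles_le (P : ObjectProperty (DerivedCategory 𝒜)) [P.IsTriangulated]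
    [P.IsStableUnderRetracts] (hP : ∀ A : 𝒜, P ((singleFunctor 𝒜 0).obj A)) :
    sumsOfSingles 𝒜 ≤ P := by
  rintro X ⟨J, _, A, i, a, b, h⟩
  exact LinearCat.prop_of_sum_eq_id P _ (fun j => P.prop_of_iso
    (((singleFunctors 𝒜).shiftIso (-i j) (i j) 0 (by lia)).app (A j))
    (P.le_shift (-i j) _ (hP (A j)))) a b h

/-- Stability of `P` under retracts is not assumed, so only the full biproduct, and not `X` itself,
is shown to lie in `P`. This is why retracts of a smaller class `G` enter in
`hasInjectiveWeakKernels`. -/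
lemma sumsOfSingles_exists_retract (P : ObjectProperty (DerivedCategory 𝒜)) [P.IsTriangulated]
    [P.IsClosedUnderIsomorphisms] (hP : ∀ A : 𝒜, P ((singleFunctor 𝒜 0).obj A))
    {X : DerivedCategory 𝒜} (hX : sumsOfSingles 𝒜 X) :
    ∃ (X' : DerivedCategory 𝒜) (_ : (sumsOfSingles 𝒜 ⊓ P) X'), Nonempty (Retract X X') := by
  obtain ⟨J, _, A, i, a, b, h⟩ := hX
  refine ⟨⨁ fun j => (singleFunctor 𝒜 (i j)).obj (A j), ⟨?_, ?_⟩, ⟨⟨biproduct.lift a,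
    biproduct.desc b, by rw [biproduct.lift_desc, h]⟩⟩⟩
  · exact ⟨J, inferInstance, A, i, biproduct.π _, biproduct.ι _, biproduct.total⟩
  · exact P.prop_of_isLimit_fan (biproduct.isLimit _) fun j => P.prop_of_iso
      (((singleFunctors 𝒜).shiftIso (-i j) (i j) 0 (by lia)).app (A j))
      (P.le_shift (-i j) _ (hP (A j)))

/-- Finite injective dimension puts every object of `𝒜` in the triangulated subcategory of bounded
complexes of injectives. Fibres stay there, and such complexes are K-injective, so they have right
resolutions. -/
theorem hasInjectiveWeakKernels_sumsOfSingles [EnoughInjectives 𝒜]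
    (h : ∀ A : 𝒜, ∃ d, HasInjectiveDimensionLT A (d + 1)) :
    LinearCat.HasInjectiveWeakKernels (sumsOfSingles 𝒜).FullSubcategory := by
  have : (isInjective 𝒜).IsClosedUnderIsomorphisms := ⟨fun e h => Injective.of_iso e h⟩
  have : (boundedComplexes (isInjective 𝒜)).IsTriangulated :=
    boundedComplexes_isTriangulated (fun _ _ (_ : Injective _) (_ : Injective _) =>
      inferInstanceAs (Injective _)) fun K L a b a' b' _ _ _ _ hK (hL : ∀ n, Injective _) f => by
        have := CochainComplex.isKInjective_of_injective L a'
        exact exists_map_eq_of_isKInjective f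
  have hs (A : 𝒜) : boundedComplexes (isInjective 𝒜) ((singleFunctor 𝒜 0).obj A) := by
    obtain ⟨d, _⟩ := h A
    exact prop_single_of_hasInjectiveDimensionLT _ (fun I hI => boundedComplexes_single hI 0) d A
  refine hasInjectiveWeakKernels inf_le_left
    (fun X hX => sumsOfSingles_exists_retract (boundedComplexes (isInjective 𝒜)) hs hX)
    fun Tr hTr h₂ h₃ => ?_
  obtain ⟨K, a, b, _, _, (hK : ∀ n, Injective _), ⟨e⟩⟩ :=
    (boundedComplexes (isInjective 𝒜)).ext_of_isTriangulatedClosed₁ Tr hTr h₂.2 h₃.2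
  have := CochainComplex.isKInjective_of_injective K a
  exact (hasRightResolution_of_isKInjective K a b).of_iso e

theorem hasInjectiveWeakKernels_op_sumsOfSingles [EnoughProjectives 𝒜]
    (h : ∀ A : 𝒜, ∃ d, HasProjectiveDimensionLT A (d + 1)) :
    LinearCat.HasInjectiveWeakKernels (sumsOfSingles 𝒜).FullSubcategoryᵒᵖ := by
  have : (isProjective 𝒜).ContainsZero := ⟨0, isZero_zero _, inferInstanceAs (Projective _)⟩
  have : (isProjective 𝒜).IsClosedUnderIsomorphisms := ⟨fun e h => Projective.of_iso e h⟩
  have : (boundedComplexes (isProjective 𝒜)).IsTriangulated :=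
    boundedComplexes_isTriangulated (fun _ _ (_ : Projective _) (_ : Projective _) =>
      inferInstanceAs (Projective _)) fun K L a b a' b' _ _ _ _ (hK : ∀ n, Projective _) hL f => by
        have := CochainComplex.isKProjective_of_projective K b
        exact exists_map_eq_of_isKProjective f
  have hs (A : 𝒜) : boundedComplexes (isProjective 𝒜) ((singleFunctor 𝒜 0).obj A) := by
    obtain ⟨d, _⟩ := h A
    exact prop_single_of_hasProjectiveDimensionLT _ (fun I hI => boundedComplexes_single hI 0) d A
  refine hasInjectiveWeakKernels_op inf_le_left
    (fun X hX => sumsOfSingles_exists_retract (boundedComplexes (isProjective 𝒜)) hs hX)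
    fun Tr hTr h₁ h₂ => ?_
  obtain ⟨K, a, b, _, _, (hK : ∀ n, Projective _), ⟨e⟩⟩ :=
    (boundedComplexes (isProjective 𝒜)).ext_of_isTriangulatedClosed₃ Tr hTr h₁.2 h₂.2
  have := CochainComplex.isKProjective_of_projective K b
  exact (hasLeftResolution_of_isKProjective K a b).of_iso e

end DerivedCategory

/-! ## Perfect pairings between spaces of morphisms -/

namespace LinearCat

open PresentedObjects

section

variable {k : Type*} [Field k] {C : Type*} [Category* C] [Preadditive C] [Linear k C]

/-- The pairing `(g, f) ↦ t (g ≫ f)` given by a linear form `t` on `C(X,Y)`. -/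
def tracePairing {X Y : C} (t : (X ⟶ Y) →ₗ[k] k) (Z : C) : (X ⟶ Z) →ₗ[k] (Z ⟶ Y) →ₗ[k] k :=
  (Linear.comp X Z Y).compr₂ t

@[simp]
lemma tracePairing_apply {X Y : C} (t : (X ⟶ Y) →ₗ[k] k) (Z : C) (g : X ⟶ Z) (f : Z ⟶ Y) :
    tracePairing t Z g f = t (g ≫ f) := rfl

/-- Perfectness passes to sums and summands in the middle variable. A form `φ` is represented by `∑
g j ≫ b j`, where `g j` represents the restriction of `φ` along `a j`. -/
lemma tracePairing_isPerfPair_of_sum {X Y Z : C} (t : (X ⟶ Y) →ₗ[k] k) {J : Type} [Fintype J]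
    (S : J → C) (hS : ∀ j, (tracePairing t (S j)).IsPerfPair) (a : ∀ j, Z ⟶ S j)
    (b : ∀ j, S j ⟶ Z) (h : ∑ j, a j ≫ b j = 𝟙 Z) : (tracePairing t Z).IsPerfPair where
  bijective_left := by
    refine ⟨(injective_iff_map_eq_zero _).2 fun g hg => ?_, fun φ => ?_⟩
    · have hg' (j : J) : g ≫ a j = 0 := by
        refine (LinearMap.IsPerfPair.bijective_left (tracePairing t (S j))).1 ?_
        rw [map_zero]
        ext f
        simpa using congr($hg (a j ≫ f))
      rw [← Category.comp_id g, ← h, Preadditive.comp_sum]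
      exact Finset.sum_eq_zero fun j _ => by rw [reassoc_of% (hg' j), zero_comp]
    · have hj (j : J) : ∃ g : X ⟶ S j, tracePairing t (S j) g = φ ∘ₗ Linear.leftComp k Y (a j) :=
        (LinearMap.IsPerfPair.bijective_left (tracePairing t (S j))).2 _
      choose g hg using hj
      refine ⟨∑ j, g j ≫ b j, LinearMap.ext fun f => ?_⟩
      have hg' (j : J) : t (g j ≫ b j ≫ f) = φ (a j ≫ b j ≫ f) := congr($(hg j) (b j ≫ f))
      conv_rhs => rw [← Category.id_comp f, ← h, Preadditive.sum_comp, map_sum]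
      simp [hg']
  bijective_right := by
    refine ⟨(injective_iff_map_eq_zero _).2 fun f hf => ?_, fun φ => ?_⟩
    · have hf' (j : J) : b j ≫ f = 0 := by
        refine (LinearMap.IsPerfPair.bijective_right (tracePairing t (S j))).1 ?_
        rw [map_zero]
        ext g
        simpa using congr($hf (g ≫ b j))
      rw [← Category.id_comp f, ← h, Preadditive.sum_comp]
      exact Finset.sum_eq_zero fun j _ => by rw [Category.assoc, hf' j, comp_zero]
    · have hj (j : J) : ∃ f : S j ⟶ Y,
          (tracePairing t (S j)).flip f = φ ∘ₗ Linear.rightComp k X (b j) :=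
        (LinearMap.IsPerfPair.bijective_right (tracePairing t (S j))).2 _
      choose f hf using hj
      refine ⟨∑ j, a j ≫ f j, LinearMap.ext fun g => ?_⟩
      have hf' (j : J) : t (g ≫ a j ≫ f j) = φ (g ≫ a j ≫ b j) := by
        simpa using congr($(hf j) (g ≫ a j))
      conv_rhs => rw [← Category.comp_id g, ← h, Preadditive.comp_sum, map_sum]
      simp [hf']

lemma tracePairing_isPerfPair_of_subsingleton {X Y : C} (t : (X ⟶ Y) →ₗ[k] k) (Z : C)
    [Subsingleton (X ⟶ Z)] [Subsingleton (Z ⟶ Y)] : (tracePairing t Z).IsPerfPair where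
  bijective_left := ⟨Function.injective_of_subsingleton _, fun _ => ⟨0, Subsingleton.elim _ _⟩⟩
  bijective_right := ⟨Function.injective_of_subsingleton _, fun _ => ⟨0, Subsingleton.elim _ _⟩⟩

end

section

variable (k : Type u) [Field k] {T : Type v₁} [Category.{max u w} T] [Preadditive T] [Linear k T]
  (P : ObjectProperty T) {X Y : T} (t : (X ⟶ Y) →ₗ[k] k)

/-- The perfect pairing is natural in `Z`, so `D T(X,-)` is represented on `P` by `Y`; `X` itself
need not lie in `P`. -/
lemma fpRight_dualCoyoneda (ht : ∀ Z, P Z → (tracePairing t Z).IsPerfPair) (hY : P Y) :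
    fpRight.{w} k P.FullSubcategory ((dualCoyoneda.{w} k P).obj X) := by
  have ht' (Z : P.FullSubcategory) := ht Z.obj Z.property
  let e : (linearYoneda k P.FullSubcategory).obj ⟨Y, hY⟩ ≅ (dualCoyoneda.{w} k P).obj X :=
    NatIso.ofComponents (fun Z => ((InducedCategory.homLinearEquiv (R := k)).trans
      (tracePairing t Z.unop.obj).flip.toPerfPair).toModuleIso) (fun {Z Z'} u => by
        ext f
        refine LinearMap.ext fun (g : X ⟶ Z'.unop.obj) => ?_
        exact congr_arg t (Category.assoc g u.unop.hom f.hom).symm)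
  exact (fp _).prop_of_iso e (fpRight_representable.{w} k _ _)

lemma fpLeft_dualYoneda (ht : ∀ Z, P Z → (tracePairing t Z).IsPerfPair) (hX : P X) :
    fpLeft.{w} k P.FullSubcategory ((dualYoneda.{w} k P).obj (op Y)) := by
  have ht' (Z : P.FullSubcategory) := ht Z.obj Z.property
  let e : (linearCoyoneda k P.FullSubcategory).obj (op ⟨X, hX⟩) ≅
      (dualYoneda.{w} k P).obj (op Y) :=
    NatIso.ofComponents (fun Z => ((InducedCategory.homLinearEquiv (R := k)).trans
      (tracePairing t Z.obj).toPerfPair).toModuleIso) (fun {Z Z'} u => by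
        ext g
        refine LinearMap.ext fun (f : Z'.obj ⟶ Y) => ?_
        exact congr_arg t (Category.assoc g.hom u.hom f))
  exact (fp _).prop_of_iso e (fpLeft_representable.{w} k _ _)

end

/-! ### The regular module and its dual, axiomatically -/

section

variable (k : Type*) [Field k] {C : Type*} [Category* C] [Abelian C] [Linear k C]

attribute [local instance] Abelian.hasFiniteBiproducts

/-- The formal properties of the regular module `G` and of its dual `E` in the category of finitely
generated modules over a finite dimensional algebra. -/
structure IsNakayamaPair (G E : C) (t : (G ⟶ E) →ₗ[k] k) : Prop where
  isSeparator : IsSeparator G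
  projective : Projective G
  finite : ∀ A : C, Module.Finite k (G ⟶ A)
  isPerfPair : ∀ A : C, (tracePairing t A).IsPerfPair

namespace IsNakayamaPair

variable {k} {G E : C} {t : (G ⟶ E) →ₗ[k] k} (h : IsNakayamaPair k G E t)

include h

lemma exists_epi (A : C) : ∃ (n : ℕ) (p : (⨁ fun _ : Fin n => G) ⟶ A), Epi p := by
  have := h.finite A
  obtain ⟨n, g, hg⟩ := Module.Finite.exists_fin (R := k) (M := G ⟶ A)
  refine ⟨n, biproduct.desc g, Preadditive.epi_of_cancel_zero _ fun {Z} f hf => ?_⟩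
  refine (Preadditive.isSeparator_iff G).1 h.isSeparator f fun x => ?_
  have hx : x ∈ LinearMap.ker (Linear.rightComp k G f) := by
    refine (Submodule.span_le (R := k)).2 ?_ (hg ▸ Submodule.mem_top : x ∈ Submodule.span k _)
    rintro _ ⟨i, rfl⟩
    simpa using biproduct.ι (fun _ : Fin n => G) i ≫= hf
  simpa using hx

/-- Finitely many maps `A ⟶ E` span all of them. If they all kill `x`, then the pairing kills `g ≫
x` for every `g` from the separator `G`, and nondegeneracy gives `x = 0`. -/
lemma exists_mono (A : C) : ∃ (n : ℕ) (i : A ⟶ ⨁ fun _ : Fin n => E), Mono i := by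
  have := h.finite A
  have := h.isPerfPair A
  have : Module.Finite k (A ⟶ E) := Module.Finite.equiv (tracePairing t A).flip.toPerfPair.symm
  obtain ⟨n, f, hf⟩ := Module.Finite.exists_fin (R := k) (M := A ⟶ E)
  refine ⟨n, biproduct.lift f, Preadditive.mono_of_cancel_zero _ fun {Z} x hx => ?_⟩
  refine (Preadditive.isSeparator_iff G).1 h.isSeparator x fun g => ?_
  refine (LinearMap.IsPerfPair.bijective_left (tracePairing t A)).1 ?_
  rw [map_zero]
  ext y
  have hy : y ∈ LinearMap.ker (Linear.leftComp k E x) := by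
    refine (Submodule.span_le (R := k)).2 ?_ (hf ▸ Submodule.mem_top : y ∈ Submodule.span k _)
    rintro _ ⟨i, rfl⟩
    simpa using hx =≫ biproduct.π (fun _ : Fin n => E) i
  have hy' : x ≫ y = 0 := by simpa using hy
  simp [hy']

lemma injective : Injective E where
  factors {A B} f i _ := by
    have := h.isPerfPair A
    have := h.isPerfPair B
    have hi : LinearMap.ker (Linear.rightComp k G i) = ⊥ := by
      rw [LinearMap.ker_eq_bot]
      exact fun x y hxy => (cancel_mono i).1 hxy
    -- Over a field the form `t (- ≫ f)` on `G ⟶ A` extends along the injection into `G ⟶ B`, by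
    -- means of `r`; perfectness at `B` represents the extension by a map `B ⟶ E`.
    obtain ⟨r, hr⟩ := LinearMap.exists_leftInverse_of_injective _ hi
    obtain ⟨f', hf'⟩ := (LinearMap.IsPerfPair.bijective_right (tracePairing t B)).2
      ((tracePairing t A).flip f ∘ₗ r)
    refine ⟨f', (LinearMap.IsPerfPair.bijective_right (tracePairing t A)).1 ?_⟩
    ext g
    have h₁ := congr($hf' (g ≫ i))
    have h₂ : r (g ≫ i) = g := congr($hr g)
    simpa [h₂] using h₁

lemma enoughProjectives : EnoughProjectives C where
  presentation A := by
    obtain ⟨n, p, _⟩ := h.exists_epi A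
    have := h.projective
    have : Projective (⨁ fun _ : Fin n => G) :=
      ⟨fun f e _ => ⟨biproduct.desc fun j => Projective.factorThru (biproduct.ι (fun _ => G) j ≫ f) e, by
        ext; simp⟩⟩
    exact ⟨{ p := _, f := p }⟩

lemma enoughInjectives : EnoughInjectives C where
  presentation A := by
    obtain ⟨n, i, _⟩ := h.exists_mono A
    have := h.injective
    exact ⟨{ J := _, f := i }⟩

lemma exists_sum_of_projective (A : C) [Projective A] :
    ∃ (n : ℕ) (a : Fin n → (A ⟶ G)) (b : Fin n → (G ⟶ A)), ∑ j, a j ≫ b j = 𝟙 A := by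
  obtain ⟨n, p, _⟩ := h.exists_epi A
  refine ⟨n, fun j => Projective.factorThru (𝟙 A) p ≫ biproduct.π (fun _ => G) j,
    fun j => biproduct.ι (fun _ => G) j ≫ p, ?_⟩
  calc
    _ = Projective.factorThru (𝟙 A) p ≫
        (∑ j, biproduct.π (fun _ : Fin n => G) j ≫ biproduct.ι (fun _ => G) j) ≫ p := by
      simp only [Preadditive.comp_sum, Preadditive.sum_comp, Category.assoc]
    _ = _ := by rw [biproduct.total, Category.id_comp, Projective.factorThru_comp]

lemma exists_sum_of_injective (A : C) [Injective A] :
    ∃ (n : ℕ) (a : Fin n → (A ⟶ E)) (b : Fin n → (E ⟶ A)), ∑ j, a j ≫ b j = 𝟙 A := by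
  obtain ⟨n, i, _⟩ := h.exists_mono A
  refine ⟨n, fun j => i ≫ biproduct.π (fun _ => E) j,
    fun j => biproduct.ι (fun _ => E) j ≫ Injective.factorThru (𝟙 A) i, ?_⟩
  calc
    _ = i ≫ (∑ j, biproduct.π (fun _ : Fin n => E) j ≫ biproduct.ι (fun _ => E) j) ≫
        Injective.factorThru (𝟙 A) i := by
      simp only [Preadditive.comp_sum, Preadditive.sum_comp, Category.assoc]
    _ = _ := by rw [biproduct.total, Category.id_comp, Injective.comp_factorThru]

end IsNakayamaPair

end

end LinearCat

/-- Both bounds say that `Ext^i` vanishes identically for `i ≥ n`. -/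
lemma hasInjectiveDimensionLT_of_hasProjectiveDimensionLT {C : Type*} [Category* C] [Abelian C]
    (n : ℕ) (h : ∀ A : C, HasProjectiveDimensionLT A n) (A : C) :
    HasInjectiveDimensionLT A n := by
  let := HasExt.standard C
  rw [hasInjectiveDimensionLT_iff]
  intro i hi Y e
  have := h Y
  exact e.eq_zero_of_hasProjectiveDimensionLT n hi

/-! ## Finite presentation of the duals in the derived category -/

namespace DerivedCategory

open Pretriangulated LinearCat ZeroObject

section

variable {𝒜 : Type*} [Category* 𝒜] [Abelian 𝒜] [HasDerivedCategory.{w} 𝒜]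

/-- The source is a K-projective complex, so morphisms are chain maps, and these vanish between
distinct degrees. -/
lemma subsingleton_hom_of_projective (A B : 𝒜) [Projective A] {n m : ℤ} (hnm : n ≠ m) :
    Subsingleton ((singleFunctor 𝒜 n).obj A ⟶ (singleFunctor 𝒜 m).obj B) := by
  let K := (CochainComplex.singleFunctor 𝒜 n).obj A
  have (i : ℤ) : Projective (K.X i) := by
    by_cases hi : i = n
    · exact Projective.of_iso (HomologicalComplex.singleObjXIsoOfEq (.up ℤ) n A i hi).symm ‹_›
    · exact (HomologicalComplex.isZero_single_obj_X (.up ℤ) n A i hi).projective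
  have := CochainComplex.isKProjective_of_projective K n
  have h₀ (f : Q.obj K ⟶ Q.obj ((CochainComplex.singleFunctor 𝒜 m).obj B)) : f = 0 := by
    obtain ⟨φ, rfl⟩ := exists_map_eq_of_isKProjective f
    have : φ = 0 := HomologicalComplex.from_single_hom_ext
      ((HomologicalComplex.isZero_single_obj_X (.up ℤ) m B n hnm).eq_of_tgt _ _)
    rw [this, Functor.map_zero]
  exact ⟨fun f g => (h₀ f).trans (h₀ g).symm⟩

lemma subsingleton_hom_of_injective (A B : 𝒜) [Injective B] {n m : ℤ} (hnm : n ≠ m) :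
    Subsingleton ((singleFunctor 𝒜 n).obj A ⟶ (singleFunctor 𝒜 m).obj B) := by
  let K := (CochainComplex.singleFunctor 𝒜 m).obj B
  have (i : ℤ) : Injective (K.X i) := by
    by_cases hi : i = m
    · exact Injective.of_iso (HomologicalComplex.singleObjXIsoOfEq (.up ℤ) m B i hi).symm ‹_›
    · exact (HomologicalComplex.isZero_single_obj_X (.up ℤ) m B i hi).injective
  have := CochainComplex.isKInjective_of_injective K m
  have h₀ (f : Q.obj ((CochainComplex.singleFunctor 𝒜 n).obj A) ⟶ Q.obj K) : f = 0 := by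
    obtain ⟨φ, rfl⟩ := exists_map_eq_of_isKInjective f
    have : φ = 0 := HomologicalComplex.from_single_hom_ext
      ((HomologicalComplex.isZero_single_obj_X (.up ℤ) m B n hnm).eq_of_tgt _ _)
    rw [this, Functor.map_zero]
  exact ⟨fun f g => (h₀ f).trans (h₀ g).symm⟩

variable (k : Type*) [Field k] [Linear k 𝒜]

/-- The functor which places an object in degree `n` is fully faithful, also linearly. -/
def singleLinearEquiv (n : ℤ) (A B : 𝒜) :
    (A ⟶ B) ≃ₗ[k] ((singleFunctor 𝒜 n).obj A ⟶ (singleFunctor 𝒜 n).obj B) :=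
  .ofBijective ((singleFunctor 𝒜 n).mapLinearMap k)
    ⟨(singleFunctor 𝒜 n).map_injective, (singleFunctor 𝒜 n).map_surjective⟩

variable {k} {G E : 𝒜} {t : (G ⟶ E) →ₗ[k] k}

/-- By additivity `Z` may sit in a single degree. In degree `n` this is the pairing of `𝒜`; in other
degrees both spaces vanish, as `G` is projective and `E` injective. -/
lemma tracePairing_single_isPerfPair (h : IsNakayamaPair k G E t) (n : ℤ)
    (Z : DerivedCategory 𝒜) (hZ : sumsOfSingles 𝒜 Z) :
    (tracePairing (t ∘ₗ (singleLinearEquiv k n G E).symm.toLinearMap) Z).IsPerfPair := by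
  obtain ⟨J, _, A, i, a, b, hab⟩ := hZ
  refine tracePairing_isPerfPair_of_sum _ _ (fun j => ?_) a b hab
  by_cases hj : n = i j
  · subst hj
    have := h.isPerfPair (A j)
    refine LinearMap.IsPerfPair.congr (tracePairing t (A j)) (singleLinearEquiv k _ _ _).symm
      (singleLinearEquiv k _ _ _).symm _ ?_
    ext g f
    refine congr_arg t ((LinearEquiv.symm_apply_eq _).2 ?_)
    exact ((singleFunctor 𝒜 _).map_comp g f).symm
  · have := h.projective
    have := h.injective
    have := subsingleton_hom_of_projective G (A j) hj
    have := subsingleton_hom_of_injective (A j) E (Ne.symm hj)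
    exact tracePairing_isPerfPair_of_subsingleton _ _

/-- Projectives are summands of powers of `G`, so finite projective dimension makes `G` generate
everything. -/
lemma prop_single_of_isNakayamaPair_left (h : IsNakayamaPair k G E t)
    (P : ObjectProperty (DerivedCategory 𝒜)) [P.IsTriangulated] [P.IsStableUnderRetracts]
    (hP : P ((singleFunctor 𝒜 0).obj G)) (d : ℕ) (A : 𝒜) [HasProjectiveDimensionLT A (d + 1)] :
    P ((singleFunctor 𝒜 0).obj A) := by
  have := h.enoughProjectives
  refine prop_single_of_hasProjectiveDimensionLT P (fun I _ => ?_) d A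
  obtain ⟨n, a, b, hab⟩ := h.exists_sum_of_projective I
  refine prop_of_sum_eq_id P _ (fun _ => hP) (fun j => (singleFunctor 𝒜 0).map (a j))
    (fun j => (singleFunctor 𝒜 0).map (b j)) ?_
  simpa [Functor.map_sum] using congr_arg (singleFunctor 𝒜 0).map hab

lemma prop_single_of_isNakayamaPair_right (h : IsNakayamaPair k G E t)
    (P : ObjectProperty (DerivedCategory 𝒜)) [P.IsTriangulated] [P.IsStableUnderRetracts]
    (hP : P ((singleFunctor 𝒜 0).obj E)) (d : ℕ) (A : 𝒜) [HasInjectiveDimensionLT A (d + 1)] :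
    P ((singleFunctor 𝒜 0).obj A) := by
  have := h.enoughInjectives
  refine prop_single_of_hasInjectiveDimensionLT P (fun I _ => ?_) d A
  obtain ⟨n, a, b, hab⟩ := h.exists_sum_of_injective I
  refine prop_of_sum_eq_id P _ (fun _ => hP) (fun j => (singleFunctor 𝒜 0).map (a j))
    (fun j => (singleFunctor 𝒜 0).map (b j)) ?_
  simpa [Functor.map_sum] using congr_arg (singleFunctor 𝒜 0).map hab

variable (k) in
/-- The objects such that the graded spaces of morphisms to `Y` are degreewise finite
dimensional. -/
def homFinite (Y : DerivedCategory 𝒜) : ObjectProperty (DerivedCategory 𝒜) := fun X =>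
  ∀ n : ℤ, Module.Finite k (X⟦n⟧ ⟶ Y)

lemma finite_hom_of_iso {X X' Y : DerivedCategory 𝒜} (e : X ≅ X') [Module.Finite k (X ⟶ Y)] :
    Module.Finite k (X' ⟶ Y) :=
  Module.Finite.of_surjective (Linear.leftComp k Y e.inv) fun f => ⟨e.hom ≫ f, by simp⟩

instance (Y : DerivedCategory 𝒜) : (homFinite k Y).IsStableUnderRetracts where
  of_retract {X X'} r hX' n := by
    have := hX' n
    exact Module.Finite.of_surjective (Linear.leftComp k Y (r.i⟦n⟧')) fun f =>
      ⟨r.r⟦n⟧' ≫ f, (r.map (shiftFunctor _ n)).retract_assoc f⟩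

instance (Y : DerivedCategory 𝒜) : (homFinite k Y).IsTriangulated where
  exists_zero := by
    refine ⟨_, isZero_zero _, fun n => ?_⟩
    have hz : IsZero ((0 : DerivedCategory 𝒜)⟦n⟧) :=
      (shiftFunctor _ n).map_isZero (isZero_zero _)
    have : Subsingleton ((0 : DerivedCategory 𝒜)⟦n⟧ ⟶ Y) := ⟨fun f g => hz.eq_of_src f g⟩
    infer_instance
  isStableUnderShiftBy m := ⟨fun X hX n => by
    have := hX (m + n)
    exact finite_hom_of_iso ((shiftFunctorAdd' _ m n (m + n) rfl).app X)⟩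
  ext₂' := (ObjectProperty.IsTriangulatedClosed₂.mk' (P := homFinite k Y)
    fun Tr hTr h₁ h₃ n => by
      have : Module.Finite k (((Triangle.shiftFunctor _ n).obj Tr).obj₁ ⟶ Y) := h₁ n
      have : Module.Finite k (((Triangle.shiftFunctor _ n).obj Tr).obj₃ ⟶ Y) := h₃ n
      have hT := Triangle.shift_distinguished _ hTr n
      have : IsNoetherian k ((Tr.obj₂)⟦n⟧ ⟶ Y) := by
        refine isNoetherian_of_range_eq_ker
          (Linear.leftComp k Y (((Triangle.shiftFunctor _ n).obj Tr).mor₂))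
          (Linear.leftComp k Y (((Triangle.shiftFunctor _ n).obj Tr).mor₁)) ?_
        ext f
        constructor
        · rintro ⟨g, rfl⟩
          have := comp_distTriang_mor_zero₁₂ _ hT =≫ g
          exact (Category.assoc _ _ _).symm.trans (this.trans zero_comp)
        · intro hf
          obtain ⟨g, hg⟩ := Triangle.yoneda_exact₂ _ hT f hf
          exact ⟨g, hg.symm⟩
      infer_instance).ext₂'

/-- Dévissage in the first variable reduces to shifts of `G`, where the space is either a `Hom` in
`𝒜` or zero; the second variable is handled by embedding into finitely many such spaces. -/
lemma finite_hom_sumsOfSingles (h : IsNakayamaPair k G E t)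
    (hd : ∃ d : ℕ, ∀ A : 𝒜, HasProjectiveDimensionLT A (d + 1)) {X Y : DerivedCategory 𝒜}
    (hX : sumsOfSingles 𝒜 X) (hY : sumsOfSingles 𝒜 Y) : Module.Finite k (X ⟶ Y) := by
  obtain ⟨d, hd⟩ := hd
  have hs (m : ℤ) (B : 𝒜) : sumsOfSingles 𝒜 ≤ homFinite k ((singleFunctor 𝒜 m).obj B) := by
    refine sumsOfSingles_le _ fun A => ?_
    have := hd A
    refine prop_single_of_isNakayamaPair_left h _ (fun n => ?_) d A
    have e := ((singleFunctors 𝒜).shiftIso n (-n) 0 (by lia)).app G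
    have : Module.Finite k ((singleFunctor 𝒜 (-n)).obj G ⟶ (singleFunctor 𝒜 m).obj B) := by
      by_cases hm : -n = m
      · subst hm
        have := h.finite B
        exact Module.Finite.equiv (singleLinearEquiv k (-n) G B)
      · have := h.projective
        have := subsingleton_hom_of_projective G B hm
        infer_instance
    exact finite_hom_of_iso e.symm
  obtain ⟨J, _, B, i, a, b, hab⟩ := hY
  have (j : J) : Module.Finite k (X ⟶ (singleFunctor 𝒜 (i j)).obj (B j)) := by
    have := hs (i j) (B j) _ hX 0
    exact finite_hom_of_iso ((shiftFunctorZero _ ℤ).app X)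
  refine Module.Finite.of_injective (LinearMap.pi fun j => Linear.rightComp k X (a j)) ?_
  refine (injective_iff_map_eq_zero _).2 fun f hf => ?_
  rw [← Category.comp_id f, ← hab, Preadditive.comp_sum]
  refine Finset.sum_eq_zero fun j _ => ?_
  have hj : f ≫ a j = 0 := congr_fun hf j
  rw [reassoc_of% hj, zero_comp]

end

section

instance {𝒜 : Type*} [Category* 𝒜] [Abelian 𝒜] [HasDerivedCategory.{w} 𝒜] :
    HasBinaryBiproducts (sumsOfSingles 𝒜).FullSubcategory where
  has_binary_biproduct X Y := hasBinaryBiproduct_of_total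
    { pt := ⟨X.obj ⊞ Y.obj, sumsOfSingles_biprod X.property Y.property⟩
      fst := ObjectProperty.homMk biprod.fst
      snd := ObjectProperty.homMk biprod.snd
      inl := ObjectProperty.homMk biprod.inl
      inr := ObjectProperty.homMk biprod.inr
      inl_fst := by ext; exact biprod.inl_fst
      inl_snd := by ext; exact biprod.inl_snd
      inr_fst := by ext; exact biprod.inr_fst
      inr_snd := by ext; exact biprod.inr_snd } (ObjectProperty.hom_ext _ (biprod.total (X := X.obj) (Y := Y.obj)))

variable {k : Type u} [Field k] {𝒜 : Type*} [Category* 𝒜] [Abelian 𝒜] [Linear k 𝒜]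
  [HasDerivedCategory.{max u w} 𝒜] {G E : 𝒜} {t : (G ⟶ E) →ₗ[k] k}

theorem sumsOfSingles_isDualizingVariety_and_isGorenstein (h : IsNakayamaPair k G E t)
    (hd : ∃ d : ℕ, ∀ A : 𝒜, HasProjectiveDimensionLT A (d + 1)) :
    IsDualizingVariety.{w} k (sumsOfSingles 𝒜).FullSubcategory ∧
      IsGorenstein.{w} k (sumsOfSingles 𝒜).FullSubcategory 1 := by
  obtain ⟨d, hd⟩ := hd
  have hd' (A : 𝒜) := hasInjectiveDimensionLT_of_hasProjectiveDimensionLT _ hd A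
  have := h.enoughProjectives
  have := h.enoughInjectives
  have hw := hasInjectiveWeakKernels_sumsOfSingles fun A : 𝒜 => ⟨d, hd' A⟩
  have hw' := hasInjectiveWeakKernels_op_sumsOfSingles fun A : 𝒜 => ⟨d, hd A⟩
  refine ⟨isDualizingVariety.{w} (fun X Y => ?_) hw hw' (fun X => ?_) (fun X => ?_),
    isGorenstein_one.{w} hw hw'⟩
  · have := finite_hom_sumsOfSingles h ⟨d, hd⟩ X.property Y.property
    exact Module.Finite.equiv (InducedCategory.homLinearEquiv (R := k)).symm
  · have := fpDualCoyoneda_isTriangulated.{w} k hw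
    have := fpDualCoyoneda_isStableUnderRetracts.{w} k hw
    -- The shift by `n` of an object in degree `0` sits in degree `-n`, and there `E` in the same
    -- degree represents the dual.
    have hG : fpDualCoyoneda.{w} k (sumsOfSingles 𝒜) ((singleFunctor 𝒜 0).obj G) := fun n =>
      (PresentedObjects.fp _).prop_of_iso ((dualCoyoneda.{w} k (sumsOfSingles 𝒜)).mapIso
        (((singleFunctors 𝒜).shiftIso n (-n) 0 (by lia)).app G).symm)
        (fpRight_dualCoyoneda.{w} k _ _ (tracePairing_single_isPerfPair h (-n))
          (sumsOfSingles_single E (-n)))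
    have hX := sumsOfSingles_le (fpDualCoyoneda.{w} k (sumsOfSingles 𝒜)) (fun A => by
      have := hd A
      exact prop_single_of_isNakayamaPair_left h _ hG d A) _ X.property 0
    exact (PresentedObjects.fp _).prop_of_iso ((dualCoyoneda.{w} k (sumsOfSingles 𝒜)).mapIso
      ((shiftFunctorZero _ ℤ).app X.obj) ≪≫ dualCoyonedaIso.{w} k X) hX
  · have := fpDualYoneda_isTriangulated.{w} k hw'
    have := fpDualYoneda_isStableUnderRetracts.{w} k hw'
    have hE : fpDualYoneda.{w} k (sumsOfSingles 𝒜) ((singleFunctor 𝒜 0).obj E) := fun n =>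
      (PresentedObjects.fp _).prop_of_iso ((dualYoneda.{w} k (sumsOfSingles 𝒜)).mapIso
        (((singleFunctors 𝒜).shiftIso n (-n) 0 (by lia)).app E).op)
        (fpLeft_dualYoneda.{w} k _ _ (tracePairing_single_isPerfPair h (-n))
          (sumsOfSingles_single G (-n)))
    have hX := sumsOfSingles_le (fpDualYoneda.{w} k (sumsOfSingles 𝒜)) (fun A => by
      have := hd' A
      exact prop_single_of_isNakayamaPair_right h _ hE d A) _ X.property 0
    exact (PresentedObjects.fp _).prop_of_iso ((dualYoneda.{w} k (sumsOfSingles 𝒜)).mapIso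
      ((shiftFunctorZero _ ℤ).app X.obj).symm.op ≪≫ dualYonedaIso.{w} k X) hX

end

end DerivedCategory

/-! ## The dual of the regular module -/

section

variable (k : Type u) (L : Type u) [Field k] [Ring L] [Algebra k L]

/-- The left `L`-module `Hom_k(L,k)`. -/
def DualRegularModule : Type u := Module.Dual k L

namespace DualRegularModule

instance : AddCommGroup (DualRegularModule k L) := inferInstanceAs (AddCommGroup (Module.Dual k L))

instance : Module k (DualRegularModule k L) := inferInstanceAs (Module k (Module.Dual k L))

instance : Module L (DualRegularModule k L) where
  smul l φ := (show Module.Dual k L from φ) ∘ₗ LinearMap.mulRight k l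
  one_smul φ := LinearMap.ext fun x => congr_arg (show Module.Dual k L from φ) (mul_one x)
  mul_smul l m φ := LinearMap.ext fun x =>
    congr_arg (show Module.Dual k L from φ) (mul_assoc x l m).symm
  smul_zero _ := rfl
  smul_add _ _ _ := rfl
  add_smul l m φ := LinearMap.ext fun x =>
    (congr_arg (show Module.Dual k L from φ) (mul_add x l m)).trans (map_add _ _ _)
  zero_smul φ := LinearMap.ext fun x =>
    (congr_arg (show Module.Dual k L from φ) (mul_zero x)).trans (map_zero _)

instance : IsScalarTower k L (DualRegularModule k L) where
  smul_assoc c l φ := LinearMap.ext fun x =>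
    (congr_arg (show Module.Dual k L from φ) (mul_smul_comm c x l)).trans (map_smul _ _ _)

instance [FiniteDimensional k L] : Module.Finite L (DualRegularModule k L) :=
  have : Module.Finite k (DualRegularModule k L) :=
    inferInstanceAs (Module.Finite k (Module.Dual k L))
  Module.Finite.of_restrictScalars_finite k L _

variable {k L}

/-- The evaluation at `1`. -/
def evalOne : DualRegularModule k L →ₗ[k] k := LinearMap.applyₗ (1 : L)

lemma evalOne_smul (l : L) (φ : DualRegularModule k L) :
    evalOne (l • φ) = (show Module.Dual k L from φ) l :=
  congr_arg (show Module.Dual k L from φ) (one_mul l)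

lemma ext_evalOne {φ : DualRegularModule k L} (h : ∀ l : L, evalOne (l • φ) = 0) : φ = 0 :=
  LinearMap.ext fun l => (evalOne_smul l φ).symm.trans (h l)

/-- The `L`-linear map to `Hom_k(L,k)` which corresponds to a `k`-linear form. -/
def ofLinearForm {A : Type*} [AddCommGroup A] [Module L A] [Module k A] [IsScalarTower k L A]
    (ψ : A →ₗ[k] k) : A →ₗ[L] DualRegularModule k L where
  toFun a := ψ ∘ₗ (LinearMap.toSpanSingleton L A a).restrictScalars k
  map_add' a b := LinearMap.ext fun l => (congr_arg ψ (smul_add l a b)).trans (map_add _ _ _)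
  map_smul' m a := LinearMap.ext fun l => congr_arg ψ (smul_smul l m a)

lemma evalOne_ofLinearForm {A : Type*} [AddCommGroup A] [Module L A] [Module k A]
    [IsScalarTower k L A] (ψ : A →ₗ[k] k) (a : A) : evalOne (ofLinearForm (L := L) ψ a) = ψ a :=
  congr_arg ψ (one_smul L a)

end DualRegularModule

end

/-! ### The pair `Λ`, `DΛ` in `mod Λ` -/

namespace FGModuleCat

open ModuleCat DualRegularModule

section

variable {L : Type u} [Ring L]

/-- The morphism from the regular module which corresponds to an element of a module. -/
def ofElement {A : FGModuleCat.{u} L} (a : A) : FGModuleCat.of L L ⟶ A :=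
  ConcreteCategory.ofHom (LinearMap.toSpanSingleton L A a)

lemma ofElement_apply_one {A : FGModuleCat.{u} L} (a : A) :
    (ofElement a).hom.hom (1 : L) = a := one_smul L a

lemma hom_ext_one {A : FGModuleCat.{u} L} {f g : FGModuleCat.of L L ⟶ A}
    (h : f.hom.hom (1 : L) = g.hom.hom (1 : L)) : f = g := by
  ext
  exact h

lemma isSeparator_regular : IsSeparator (FGModuleCat.of L L) := by
  rw [Preadditive.isSeparator_iff]
  intro X Y f hf
  ext x
  have := congr(($(hf (ofElement x))).hom.hom (1 : L))
  rw [FGModuleCat.hom_hom_comp, LinearMap.comp_apply, ofElement_apply_one] at this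
  exact this

lemma projective_regular [IsNoetherianRing L] : Projective (FGModuleCat.of L L) where
  factors {E X} f e _ := by
    have he : Epi ((forget₂ (FGModuleCat L) (ModuleCat L)).map e) := inferInstance
    obtain ⟨y, hy⟩ := (ModuleCat.epi_iff_surjective _).1 he (f.hom.hom (1 : L))
    refine ⟨ofElement y, hom_ext_one ?_⟩
    rw [FGModuleCat.hom_hom_comp, LinearMap.comp_apply, ofElement_apply_one]
    exact hy

end

variable (k : Type u) (L : Type u) [Field k] [Ring L] [Algebra k L] [FiniteDimensional k L]

/-- The linear form `f ↦ f(1)(1)` on the space of morphisms from the regular module to its dual. -/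
def regularTrace :
    (FGModuleCat.of L L ⟶ FGModuleCat.of L (DualRegularModule k L)) →ₗ[k] k where
  toFun f := evalOne (f.hom.hom (1 : L))
  map_add' _ _ := rfl
  map_smul' c f := by
    have : (c • f).hom.hom (1 : L) = c • (show DualRegularModule k L from f.hom.hom (1 : L)) :=
      algebraMap_smul L c (show DualRegularModule k L from f.hom.hom (1 : L))
    rw [this, map_smul]
    rfl

lemma finite_regular_hom (A : FGModuleCat.{u} L) :
    Module.Finite k (FGModuleCat.of L L ⟶ A) := by
  have : Module.Finite k A.obj := Module.Finite.trans L A.obj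
  let e : (FGModuleCat.of L L ⟶ A) →ₗ[k] A.obj :=
    { toFun := fun f => f.hom.hom (1 : L)
      map_add' := fun _ _ => rfl
      map_smul' := fun _ _ => rfl }
  exact Module.Finite.of_injective e fun f g h => hom_ext_one h

/-- Under `Hom(Λ, A) = A` and `Hom(A, DΛ) = Hom_k(A, k)` the trace pairing becomes evaluation of
forms on the finite dimensional space `A`. By finiteness, injectivity on both sides is enough. -/
lemma isNakayamaPair [IsNoetherianRing L] :
    LinearCat.IsNakayamaPair k (FGModuleCat.of L L) (FGModuleCat.of L (DualRegularModule k L))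
      (regularTrace k L) where
  isSeparator := isSeparator_regular
  projective := projective_regular
  finite := finite_regular_hom k L
  isPerfPair A := by
    have := finite_regular_hom k L A
    refine LinearMap.IsPerfPair.of_injective ((injective_iff_map_eq_zero _).2 fun g hg => ?_)
      ((injective_iff_map_eq_zero _).2 fun f hf => ?_)
    · refine hom_ext_one ((Module.forall_dual_apply_eq_zero_iff k
        (show A.obj from g.hom.hom (1 : L))).1 fun ψ => ?_)
      have h₁ : evalOne (ofLinearForm (L := L) ψ (g.hom.hom (1 : L))) = 0 :=
        congr($hg (ConcreteCategory.ofHom (ofLinearForm ψ)))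
      exact (evalOne_ofLinearForm ψ _).symm.trans h₁
    · ext x
      refine ext_evalOne fun l => ?_
      -- Pairing with the element `l • x` reads off the value of the form `f x` at `l`.
      have h₁ : evalOne (f.hom.hom ((ofElement (l • x)).hom.hom (1 : L))) = 0 :=
        congr($hf (ofElement (l • x)))
      rw [ofElement_apply_one, map_smul] at h₁
      exact h₁

end FGModuleCat

/-! ### The Yoneda category in terms of complexes in a single degree -/

section

open DerivedCategory

variable (L : Type u) [Ring L] [IsNoetherianRing L]
  [HasDerivedCategory.{max u w} (FGModuleCat.{u} L)]

lemma yonedaProperty_eq_sumsOfSingles :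
    yonedaProperty.{w} L = sumsOfSingles (FGModuleCat.{u} L) := by
  ext X
  constructor
  · rintro ⟨n, A, i, ⟨r⟩⟩
    exact (sumsOfSingles _).prop_of_retract r (sumsOfSingles_of_sum _
      (fun j => (sumsOfSingles _).le_shift (i j) _ (sumsOfSingles_single (A j) 0))
      (biproduct.π _) (biproduct.ι _) biproduct.total)
  · rintro ⟨J, _, A, i, a, b, h⟩
    let e := (Fintype.equivFin J).symm
    -- An object in degree `i` is the shift by `-i` of the same object in degree `0`, hence the sign
    -- in the witness below.
    let s (j : J) := ((singleFunctors (FGModuleCat.{u} L)).shiftIso (-i j) (i j) 0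
      (by lia)).app (A j)
    refine ⟨Fintype.card J, A ∘ e, fun j => -i (e j), ⟨⟨biproduct.lift fun j => a (e j) ≫ (s _).inv,
      biproduct.desc fun j => (s _).hom ≫ b (e j), ?_⟩⟩⟩
    rw [biproduct.lift_desc, ← h, ← e.sum_comp]
    simp

end

end

theorem theorem3p1 (k : Type u) (L : Type u) [Field k] [Ring L] [Algebra k L]
    [FiniteDimensional k L] :
    haveI : IsNoetherianRing L := isNoetherianRing_of_finiteDimensional k L
    ∀ [HasDerivedCategory.{max u w} (FGModuleCat.{u} L)], HasFiniteGlobalDimension L →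
      LinearCat.IsDualizingVariety.{w} k (YonedaCategory.{w} L) ∧
        LinearCat.IsGorenstein.{w} k (YonedaCategory.{w} L) 1 := by
  have := isNoetherianRing_of_finiteDimensional k L
  rintro _ ⟨n, hn⟩
  change LinearCat.IsDualizingVariety.{w} k (yonedaProperty.{w} L).FullSubcategory ∧
    LinearCat.IsGorenstein.{w} k (yonedaProperty.{w} L).FullSubcategory 1
  rw [yonedaProperty_eq_sumsOfSingles]
  -- Projective dimension at most `n` is the strict bound `n + 1`, so the same `n` serves.
  exact DerivedCategory.sumsOfSingles_isDualizingVariety_and_isGorenstein (FGModuleCat.isNakayamaPair k L) ⟨n, hn⟩
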